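/- **Setting.** Let $a,b\ge 0$. Let $\mathcal A$ and $\mathcal B$ be the sets of density matrices (positive semidefinite, trace one) of size $2^a\times 2^a$ and $2^b\times 2^b$, and $\mathcal Z=\mathcal A\times\mathcal B$, with the inner product $\langle z,w\rangle$ and the norm $\|\cdot\|$ the Hilbert–Schmidt inner product and the Frobenius norm on pairs. A quantum zero-sum game is given by a finite POVM $(P_\omega)_{\omega\in\Omega}$ on $\mathbb C^{2^a}\otimes\mathbb C^{2^b}$ and utilities $\mathcal U(\omega)\in[-1,1]$. Put $U=\sum_\omega\mathcal U(\omega)P_\omega$, $p(\alpha,\beta)=\operatorname{tr}(U^\dagger(\alpha\otimes\beta))=\operatorname{tr}(\alpha F(\beta))$ with $F(\beta)=\operatorname{Tr}_{\mathcal B}[U^\dagger(I\otimes\beta)]$ and $F^*(\alpha)=\operatorname{Tr}_{\mathcal A}[U^\dagger(\alpha\otimes I)]$, and let $\mathcal F(\alpha,\beta)=(F(\beta),-F^*(\alpha))$, with operator norm $\|\mathcal F\|=\sup\{\langle \mathcal F(z),w\rangle:\|z\|=\|w\|=1\}$ over pairs of Hermitian matrices. The duality gap is $\mathrm{gap}(\alpha,\beta)=\max_{\beta'\in\mathcal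 B}p(\alpha,\beta')-\min_{\alpha'\in\mathcal A}p(\alpha',\beta)$. An $\epsilon$-equilibrium is a $z\in\mathcal Z$ with $\mathrm{gap}(z)\le\epsilon$. Let $\mathrm{dist}(z)$ be the distance from $z$ to $\operatorname{argmin}_{\mathcal Z}\mathrm{gap}$. The error-bound modulus is $$\delta(F)=\sup\{\delta>0:\ \mathrm{dist}(z)\le \mathrm{gap}(z)/\delta\ \text{ for all } z\in\mathcal Z\}\in[0,\infty]\qquad(\sup\emptyset=0),$$ and $\kappa(F)=\|\mathcal F\|/\delta(F)\in[0,\infty]$, where $x/0=+\infty$ for $x>0$ and $x/\infty=0$. **Algorithm.** Fix $\tilde z\in\mathcal Z$, let $r(z)=\frac12\|z-\tilde z\|^2$ and $D_{\max}=\max_{\mathcal Z}r$. The procedure *Smoothing*$(z_0,e)$ sets $\mu=e/(2D_{\max})$, $L=\|\mathcal F\|^2/\mu$, $w_0=z_0$, and in its first-order iterations $k=0,1,2,\dots$ computes $$u_k=\tfrac{2}{k+2}w_k+\tfrac{k}{k+2}z_k,\qquad g_k=\mathcal F\Big(\operatorname*{argmax}_{(\alpha',\beta')\in\mathcal Z}\{p(u_k^{\mathcal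 A},\beta')-p(\alpha',u_k^{\mathcal B})-\mu\, r(\alpha',\beta')\}\Big),$$ where $u_k=(u_k^{\mathcal A},u_k^{\mathcal B})$, and $$z_{k+1}=\operatorname*{argmin}_{y\in\mathcal Z}\{\langle g_k,y-u_k\rangle+\tfrac L2\|y-u_k\|^2\},\qquad w_{k+1}=\operatorname*{argmin}_{y\in\mathcal Z}\Big\{\sum_{i\le k}\tfrac{i+1}{2}\langle g_i,y\rangle+\tfrac L2\|y-z_0\|^2\Big\}.$$ It returns the first $z_{k+1}$ with $\mathrm{gap}(z_{k+1})\le e$. For $\gamma>1$, $\epsilon>0$ and a starting point $z_0\in\mathcal Z$, *IterSmooth* starts with $z=z_0$, $e=\mathrm{gap}(z_0)$; as long as $\mathrm{gap}(z)>\epsilon$ it replaces $e$ by $e/\gamma$ and then $z$ by Smoothing$(z,e)$; then it returns $z$. Its iteration count is the total number of first-order iterations over all calls of Smoothing. **Theorem.** Let $\gamma>1$. 1. There is a constant $C>0$, depending only on $\gamma$, such that for all $a,b$, all quantum zero-sum games, all $\tilde z,z_0\in\mathcal Z$ and all $0<\epsilon\le\|\mathcal F\|/2$, IterSmooth terminates,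 returns an $\epsilon$-equilibrium, and uses at most $$C\,\kappa(F)\,\ln(\|\mathcal F\|/\epsilon)$$ first-order iterations. 2. For all $a,b$, all quantum zero-sum games, all $\tilde z,z_0\in\mathcal Z$ and all $\epsilon>0$, IterSmooth terminates, returns an $\epsilon$-equilibrium, and uses at most $$\max\Big\{0,\Big\lceil\frac{\ln(2\|\mathcal F\|/\epsilon)}{\ln\gamma}\Big\rceil\Big\}\cdot\left\lceil\frac{2\sqrt2\,\gamma\,\|\mathcal F\|\,\sqrt{D_{\max}}}{\delta(F)}\right\rceil$$ first-order iterations (if $\mathcal F=0$ the count is $0$; $0\cdot\infty=0$). If $\delta(F)=0$, so that the game admits no error bound, a bound in which $\delta(F)$ or $\kappa(F)$ appears with a nonzero cofactor is $+\infty$; termination and the correctness of the output are still asserted. -/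

import Mathlib

open scoped ENNReal Kronecker ComplexOrder

noncomputable section

/-- Complex matrices acting on the state space of `d` qubits. -/
abbrev QMat (d : ℕ) : Type := Matrix (Fin (2 ^ d)) (Fin (2 ^ d)) ℂ

/-- Pairs of matrices, one for each of the two players. -/
abbrev JointMat (a b : ℕ) : Type := QMat a × QMat b

/-- The density matrices on `d` qubits (the spectraplex). -/
def spectraplex (d : ℕ) : Set (QMat d) := {A | A.PosSemidef ∧ A.trace = 1}

/-- The joint state space: pairs of density matrices. -/
def jointStates (a b : ℕ) : Set (JointMat a b) := spectraplex a ×ˢ spectraplex b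

/-- Pairs of Hermitian matrices. -/
def jointHermitian (a b : ℕ) : Set (JointMat a b) := {z | z.1.IsHermitian ∧ z.2.IsHermitian}

/-- The Hilbert-Schmidt inner product `tr (A† B)`; on Hermitian matrices it is a real number, and
the real part does not lose anything. -/
def hsInner {d : ℕ} (A B : QMat d) : ℝ := ((A.conjTranspose * B).trace).re

/-- The Hilbert-Schmidt inner product on pairs. -/
def jointInner {a b : ℕ} (z w : JointMat a b) : ℝ := hsInner z.1 w.1 + hsInner z.2 w.2

/-- The Frobenius norm on pairs. -/
def jointNorm {a b : ℕ} (z : JointMat a b) : ℝ := Real.sqrt (jointInner z z)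

/-- A point of `S` that minimizes `f` over `S` (if there is one). -/
def argminOn {E : Type*} [Nonempty E] (f : E → ℝ) (S : Set E) : E :=
  Classical.epsilon fun x => x ∈ S ∧ IsMinOn f S x

/-- A point of `S` that maximizes `f` over `S` (if there is one). -/
def argmaxOn {E : Type*} [Nonempty E] (f : E → ℝ) (S : Set E) : E :=
  Classical.epsilon fun x => x ∈ S ∧ IsMaxOn f S x

/-- A non-interactive refereed quantum zero-sum game: Alice sends an `a`-qubit state, Bob sends a
`b`-qubit state, and the referee measures the product state with a finite POVM and pays a utility
in `[-1, 1]` that depends on the outcome. -/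
structure QuantumGame (a b : ℕ) (Ω : Type*) [Fintype Ω] where
  povm : Ω → Matrix (Fin (2 ^ a) × Fin (2 ^ b)) (Fin (2 ^ a) × Fin (2 ^ b)) ℂ
  povm_posSemidef : ∀ ω, (povm ω).PosSemidef
  povm_sum : ∑ ω, povm ω = 1
  utility : Ω → ℝ
  utility_mem : ∀ ω, utility ω ∈ Set.Icc (-1 : ℝ) 1

namespace QuantumGame

variable {a b : ℕ} {Ω : Type*} [Fintype Ω] (G : QuantumGame a b Ω)

/-- The payoff observable `U = ∑ ω, 𝒰(ω) P_ω`. -/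
def observable : Matrix (Fin (2 ^ a) × Fin (2 ^ b)) (Fin (2 ^ a) × Fin (2 ^ b)) ℂ :=
  ∑ ω, (G.utility ω : ℂ) • G.povm ω

/-- The expected payoff `tr (U† (α ⊗ β))`; the first player minimizes it, the second maximizes. -/
def payoff (α : QMat a) (β : QMat b) : ℝ := ((G.observable.conjTranspose * (α ⊗ₖ β)).trace).re

/-- The superoperator `F(β) = Tr_B [U† (1 ⊗ β)]`, so that `payoff α β = tr (α F(β))`. -/
def superop (β : QMat b) : QMat a := Matrix.of fun i j =>
  ∑ k, (G.observable.conjTranspose * ((1 : QMat a) ⊗ₖ β)) (i, k) (j, k)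

/-- The adjoint superoperator `F*(α) = Tr_A [U† (α ⊗ 1)]`, so that `payoff α β = tr (F*(α) β)`. -/
def superopAdj (α : QMat a) : QMat b := Matrix.of fun i j =>
  ∑ k, (G.observable.conjTranspose * (α ⊗ₖ (1 : QMat b))) (k, i) (k, j)

/-- The joint payoff gradient `(F(β), -F*(α))`. -/
def grad (z : JointMat a b) : JointMat a b := (G.superop z.2, -G.superopAdj z.1)

/-- The operator norm of the joint payoff gradient with respect to the Frobenius norm. -/
def opNorm : ℝ := sSup {t | ∃ z ∈ jointHermitian a b, ∃ w ∈ jointHermitian a b,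
  jointNorm z = 1 ∧ jointNorm w = 1 ∧ t = jointInner (G.grad z) w}

/-- The upper value function `max_β payoff α β`. -/
def upperValue (α : QMat a) : ℝ := sSup ((fun β => G.payoff α β) '' spectraplex b)

/-- The lower value function `min_α payoff α β`. -/
def lowerValue (β : QMat b) : ℝ := sInf ((fun α => G.payoff α β) '' spectraplex a)

/-- The duality gap. -/
def gap (z : JointMat a b) : ℝ := G.upperValue z.1 - G.lowerValue z.2

/-- `z` is an `ε`-equilibrium: a joint state whose duality gap is at most `ε`. -/
def IsEpsEquilibrium (ε : ℝ) (z : JointMat a b) : Prop := z ∈ jointStates a b ∧ G.gap z ≤ ε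

/-- The set of joint states of minimal duality gap. -/
def opt : Set (JointMat a b) := {z | z ∈ jointStates a b ∧ IsMinOn G.gap (jointStates a b) z}

/-- The Frobenius distance to the set of optimal joint states. -/
def dist (z : JointMat a b) : ℝ := sInf ((fun w => jointNorm (z - w)) '' G.opt)

/-- The error-bound modulus: the supremum, in `[0, ∞]`, of all `d > 0` such that
`dist z ≤ gap z / d` for all joint states `z`. It is `0` if there is no such `d`, and `∞` if every
joint state is optimal. -/
def modulus : ℝ≥0∞ :=
  ⨆ (d : ℝ) (_ : 0 < d ∧ ∀ z ∈ jointStates a b, G.dist z ≤ G.gap z / d), ENNReal.ofReal d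

/-- The condition measure `κ = ‖F‖ / δ`, in `[0, ∞]`. -/
def condMeasure : ℝ≥0∞ := ENNReal.ofReal G.opNorm / G.modulus

end QuantumGame

/-- The quadratic regularizer with reference point `zref`. -/
def regularizer {a b : ℕ} (zref z : JointMat a b) : ℝ := jointNorm (z - zref) ^ 2 / 2

/-- The maximum of the regularizer over the joint state space. -/
def regMax {a b : ℕ} (zref : JointMat a b) : ℝ := sSup (regularizer zref '' jointStates a b)

/-- The state of the accelerated scheme: the current iterate, the current dual-averaging point, and
the weighted sum of the gradients seen so far. -/
structure SmoothingState (a b : ℕ) where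
  iterate : JointMat a b
  dual : JointMat a b
  gradSum : JointMat a b

namespace QuantumGame

variable {a b : ℕ} {Ω : Type*} [Fintype Ω] (G : QuantumGame a b Ω)

/-- The maximizer in the definition of the smoothed duality gap
`max_{z'} {payoff α β' - payoff α' β - μ r(z')}` at the point `z = (α, β)`. -/
def smoothedMaximizer (zref : JointMat a b) (μ : ℝ) (z : JointMat a b) : JointMat a b :=
  argmaxOn (fun z' => G.payoff z.1 z'.2 - G.payoff z'.1 z.2 - μ * regularizer zref z')
    (jointStates a b)

/-- The gradient of the smoothed duality gap. -/
def smoothedGrad (zref : JointMat a b) (μ : ℝ) (z : JointMat a b) : JointMat a b :=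
  G.grad (G.smoothedMaximizer zref μ z)

/-- The smoothing parameter `μ = e / (2 D)` for the target accuracy `e`. -/
def smoothingParam (zref : JointMat a b) (e : ℝ) : ℝ := e / (2 * regMax zref)

/-- The Lipschitz constant `‖F‖² / μ` of the gradient of the smoothed duality gap. -/
def lipConst (zref : JointMat a b) (e : ℝ) : ℝ := G.opNorm ^ 2 / smoothingParam zref e

/-- One first-order iteration, number `k = 0, 1, …`, of Nesterov's accelerated method on the
smoothed duality gap for the target accuracy `e`, when started at `z₀`. With
`u = 2/(k+2) w + k/(k+2) z` and `g` the gradient at `u`, the new iterate minimizes the quadratic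
upper model `⟨g, y - u⟩ + L/2 ‖y - u‖²` over the joint states, and the new dual-averaging point
minimizes `∑_{i ≤ k} (i+1)/2 ⟨gᵢ, y⟩ + L/2 ‖y - z₀‖²`. -/
def smoothingStep (zref : JointMat a b) (e : ℝ) (z₀ : JointMat a b) (k : ℕ)
    (s : SmoothingState a b) : SmoothingState a b :=
  let u : JointMat a b := (2 / ((k : ℝ) + 2)) • s.dual + ((k : ℝ) / ((k : ℝ) + 2)) • s.iterate
  let g : JointMat a b := G.smoothedGrad zref (smoothingParam zref e) u
  let gs : JointMat a b := s.gradSum + (((k : ℝ) + 1) / 2) • g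
  let L : ℝ := G.lipConst zref e
  { iterate := argminOn (fun y => jointInner g (y - u) + L / 2 * jointNorm (y - u) ^ 2)
      (jointStates a b)
    dual := argminOn (fun y => jointInner gs y + L / 2 * jointNorm (y - z₀) ^ 2)
      (jointStates a b)
    gradSum := gs }

/-- The state of the smoothing procedure after `k` iterations. -/
def smoothingState (zref : JointMat a b) (e : ℝ) (z₀ : JointMat a b) : ℕ → SmoothingState a b
  | 0 => { iterate := z₀, dual := z₀, gradSum := 0 }
  | k + 1 => G.smoothingStep zref e z₀ k (smoothingState zref e z₀ k)

/-- The smoothing procedure with target accuracy `e`, started at `z₀`, stops after exactly `k`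
iterations and returns `z`: it stops after the first iteration whose iterate has duality gap at
most `e`. -/
def SmoothingReturns (zref : JointMat a b) (e : ℝ) (z₀ : JointMat a b) (k : ℕ)
    (z : JointMat a b) : Prop :=
  1 ≤ k ∧ z = (G.smoothingState zref e z₀ k).iterate ∧ G.gap z ≤ e ∧
    ∀ j, 1 ≤ j → j < k → e < G.gap (G.smoothingState zref e z₀ j).iterate

/-- The outer loop: from the current point `z` and the current accuracy `e`, it stops after a total
of `n` further first-order iterations and returns `out`. It stops as soon as the duality gap is at
most `ε`; otherwise it divides the accuracy by `γ` and restarts the smoothing procedure at the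
current point. -/
inductive OuterLoop (zref : JointMat a b) (γ ε : ℝ) :
    JointMat a b → ℝ → ℕ → JointMat a b → Prop
  | halt {z : JointMat a b} {e : ℝ} (h : G.gap z ≤ ε) : OuterLoop zref γ ε z e 0 z
  | restart {z z' out : JointMat a b} {e : ℝ} {k n : ℕ} (h : ε < G.gap z)
      (hcall : G.SmoothingReturns zref (e / γ) z k z')
      (hrest : OuterLoop zref γ ε z' (e / γ) n out) : OuterLoop zref γ ε z e (k + n) out

/-- `IterSmooth` with decay factor `γ` and target `ε`, started at `z₀` with initial accuracy
`gap z₀`, terminates after a total of `n` first-order iterations and returns `out`. -/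
def IterSmooth (zref : JointMat a b) (γ ε : ℝ) (z₀ : JointMat a b) (n : ℕ)
    (out : JointMat a b) : Prop :=
  G.OuterLoop zref γ ε z₀ (G.gap z₀) n out

end QuantumGame

end

/-! The duality gap at `z` is the maximum over `w` of the skew form `saddleForm w z`. Subtracting
`μ` times the regularizer inside the maximum gives a smoothed gap `f` that lies below the gap by at
most `μ D`, where `D = regMax zref`; the choice of `μ` makes this error `e / 2`. Strong concavity in
`w` gives `f` a quadratic upper model with constant `L = ‖F‖² / μ` (`smoothedGap_upper`).

For the accelerated scheme, an estimate-sequence invariant (`EstimateInvariant.step`) yields `f(z_k)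
- f(y) ≤ 2 L ‖y - z₀‖² / (k (k + 1))`. Take `y` to be the optimal state nearest to `z₀`. By the
minimax theorem its gap is `0`, so `f(y) ≤ 0`, and about `2√2 ‖F‖ √D dist(z₀) / e` iterations
suffice (`gap_smoothingState_le`). The minimax theorem itself comes from the smoothing: the
first-order condition at a minimizer of `f` shows `min f ≤ 0`, and then `μ → 0`.

A restart begins with gap at most `γ e`, so the error bound gives `dist(z₀) ≤ γ e / δ`. The accuracy
`e` cancels, and every call costs at most the same number of iterations (`smoothingReturns_call`).
Since the gap never exceeds `2 ‖F‖`, there are at most `⌈log (2 ‖F‖ / ε) / log γ⌉` calls. The first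
bound follows from the second because `D ≤ 4`, while `√2 κ ≥ 1` and `log (‖F‖ / ε) ≥ log 2` absorb
the two roundings. Termination with `δ = 0` needs only the convergence rate, which does not involve
`δ`. -/

noncomputable section

/-! ### The Hilbert–Schmidt geometry of pairs of matrices. -/

section HilbertSchmidt

variable {d a b : ℕ}

lemma hsInner_add_left (A B C : QMat d) : hsInner (A + B) C = hsInner A C + hsInner B C := by
  simp [hsInner, add_mul]

lemma hsInner_smul_left (t : ℝ) (A B : QMat d) : hsInner (t • A) B = t * hsInner A B := by
  simp [hsInner, Matrix.conjTranspose_smul]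

lemma hsInner_comm (A B : QMat d) : hsInner A B = hsInner B A := by
  have h : (A.conjTranspose * B).trace = star (B.conjTranspose * A).trace := by
    rw [← Matrix.trace_conjTranspose, Matrix.conjTranspose_mul, Matrix.conjTranspose_conjTranspose]
  simp [hsInner, h]

lemma hsInner_self (A : QMat d) : hsInner A A = ∑ i, ∑ j, ‖A i j‖ ^ 2 := by
  rw [Finset.sum_comm]
  simp only [hsInner, Matrix.trace, Matrix.diag, Matrix.mul_apply, Matrix.conjTranspose_apply,
    Complex.re_sum]
  refine Finset.sum_congr rfl fun i _ => Finset.sum_congr rfl fun j _ => ?_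
  rw [Complex.star_def, Complex.conj_mul']
  norm_cast

lemma hsInner_self_nonneg (A : QMat d) : 0 ≤ hsInner A A := by
  rw [hsInner_self]; positivity

lemma eq_zero_of_hsInner_self (A : QMat d) (h : hsInner A A = 0) : A = 0 := by
  rw [hsInner_self, Finset.sum_eq_zero_iff_of_nonneg fun i _ => by positivity] at h
  ext i j
  have hi := h i (Finset.mem_univ i)
  rw [Finset.sum_eq_zero_iff_of_nonneg fun i _ => by positivity] at hi
  simpa using hi j (Finset.mem_univ j)

/-- The Hilbert-Schmidt inner product on pairs, as a real bilinear form. -/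
def jointForm (a b : ℕ) : LinearMap.BilinForm ℝ (JointMat a b) :=
  LinearMap.mk₂ ℝ jointInner
    (fun x y z => by simp only [jointInner, Prod.fst_add, Prod.snd_add, hsInner_add_left]; ring)
    (fun t x y => by
      simp only [jointInner, Prod.smul_fst, Prod.smul_snd, hsInner_smul_left, smul_eq_mul]; ring)
    (fun x y z => by
      simp only [jointInner, Prod.fst_add, Prod.snd_add, hsInner_comm x.1, hsInner_comm x.2,
        hsInner_add_left]; ring)
    (fun t x y => by
      simp only [jointInner, Prod.smul_fst, Prod.smul_snd, hsInner_comm x.1, hsInner_comm x.2,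
        hsInner_smul_left, smul_eq_mul]; ring)

lemma jointInner_eq (z w : JointMat a b) : jointInner z w = jointForm a b z w := rfl

lemma jointForm_comm (z w : JointMat a b) : jointForm a b z w = jointForm a b w z := by
  simp only [← jointInner_eq, jointInner, hsInner_comm z.1, hsInner_comm z.2]

lemma jointForm_self_nonneg (z : JointMat a b) : 0 ≤ jointForm a b z z :=
  add_nonneg (hsInner_self_nonneg _) (hsInner_self_nonneg _)

lemma eq_zero_of_jointForm_self {z : JointMat a b} (h : jointForm a b z z = 0) : z = 0 := by
  have h1 := hsInner_self_nonneg z.1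
  have h2 := hsInner_self_nonneg z.2
  rw [← jointInner_eq, jointInner] at h
  exact Prod.ext (eq_zero_of_hsInner_self _ (by linarith)) (eq_zero_of_hsInner_self _ (by linarith))

lemma jointNorm_sq (z : JointMat a b) : jointNorm z ^ 2 = jointForm a b z z :=
  Real.sq_sqrt (jointForm_self_nonneg z)

lemma jointNorm_nonneg (z : JointMat a b) : 0 ≤ jointNorm z := Real.sqrt_nonneg _

lemma jointNorm_pos {z : JointMat a b} (h : z ≠ 0) : 0 < jointNorm z := by
  refine (jointNorm_nonneg z).lt_of_ne fun h0 => h (eq_zero_of_jointForm_self ?_)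
  rw [← jointNorm_sq, ← h0]; norm_num

lemma jointNorm_zero : jointNorm (0 : JointMat a b) = 0 := by
  simp [jointNorm, jointInner_eq]

lemma jointNorm_smul (t : ℝ) (z : JointMat a b) : jointNorm (t • z) = |t| * jointNorm z := by
  rw [jointNorm, jointInner_eq, map_smul, LinearMap.map_smul, LinearMap.smul_apply, smul_eq_mul,
    smul_eq_mul, ← mul_assoc, Real.sqrt_mul (mul_self_nonneg t), Real.sqrt_mul_self_eq_abs]
  rfl

lemma continuous_jointForm {X : Type*} [TopologicalSpace X] {f g : X → JointMat a b}
    (hf : Continuous f) (hg : Continuous g) : Continuous fun x => jointForm a b (f x) (g x) := by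
  simp only [← jointInner_eq, jointInner, hsInner]
  fun_prop

lemma continuous_jointNorm : Continuous (jointNorm : JointMat a b → ℝ) := by
  have h : Continuous fun z : JointMat a b => √(jointForm a b z z) :=
    (continuous_jointForm continuous_id continuous_id).sqrt
  exact h

lemma norm_apply_le_one {A : QMat d} (h : hsInner A A ≤ 1) (i j : Fin (2 ^ d)) :
    ‖A i j‖ ≤ 1 := by
  rw [hsInner_self] at h
  have h1 : ‖A i j‖ ^ 2 ≤ ∑ j, ‖A i j‖ ^ 2 :=
    Finset.single_le_sum (f := fun j => ‖A i j‖ ^ 2) (fun _ _ => by positivity) (Finset.mem_univ j)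
  have h2 : ∑ j, ‖A i j‖ ^ 2 ≤ ∑ i, ∑ j, ‖A i j‖ ^ 2 :=
    Finset.single_le_sum (f := fun i => ∑ j, ‖A i j‖ ^ 2) (fun _ _ => by positivity)
      (Finset.mem_univ i)
  have := norm_nonneg (A i j)
  nlinarith

lemma isCompact_hsBall (d : ℕ) : IsCompact {A : QMat d | hsInner A A ≤ 1} := by
  have h : IsCompact (Set.univ.pi fun _ : Fin (2 ^ d) => Set.univ.pi fun _ : Fin (2 ^ d) =>
      Metric.closedBall (0 : ℂ) 1) :=
    isCompact_univ_pi fun _ => isCompact_univ_pi fun _ => isCompact_closedBall _ _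
  have hc : IsClosed {A : QMat d | hsInner A A ≤ 1} :=
    isClosed_le (by simp only [hsInner]; fun_prop) continuous_const
  exact h.of_isClosed_subset hc fun A hA i _ j _ => by simpa using norm_apply_le_one hA i j

/-- Needed so that the supremum in `opNorm` is over a bounded set. -/
lemma isCompact_jointHermitian_unitSphere (a b : ℕ) :
    IsCompact {z : JointMat a b | z ∈ jointHermitian a b ∧ jointNorm z = 1} := by
  refine ((isCompact_hsBall a).prod (isCompact_hsBall b)).of_isClosed_subset ?_ ?_
  · have h1 : IsClosed {z : JointMat a b | z.1.conjTranspose = z.1} :=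
      isClosed_eq (by fun_prop) (by fun_prop)
    have h2 : IsClosed {z : JointMat a b | z.2.conjTranspose = z.2} :=
      isClosed_eq (by fun_prop) (by fun_prop)
    exact (h1.inter h2).inter (isClosed_eq continuous_jointNorm continuous_const)
  · rintro z ⟨-, hz⟩
    have h : jointInner z z = 1 := by rw [jointInner_eq, ← jointNorm_sq, hz, one_pow]
    have h1 := hsInner_self_nonneg z.1
    have h2 := hsInner_self_nonneg z.2
    rw [jointInner] at h
    refine ⟨?_, ?_⟩ <;> simp only [Set.mem_ofPred_eq] <;> linarith

end HilbertSchmidt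

/-! ### Convexity, compactness and diameter of the sets of states. -/

section Spectraplex

variable {d a b : ℕ}

lemma convex_spectraplex (d : ℕ) : Convex ℝ (spectraplex d) := by
  rintro A ⟨hA, hA'⟩ B ⟨hB, hB'⟩ s t hs ht hst
  refine ⟨(hA.smul hs).add (hB.smul ht), ?_⟩
  rw [Matrix.trace_add, Matrix.trace_smul, Matrix.trace_smul, hA', hB']
  simp only [Complex.real_smul, mul_one]
  exact_mod_cast hst

/-- The `2 × 2` submatrix on the indices `i, j` is positive semidefinite, also when `i = j`, so its
determinant is nonnegative. -/
lemma norm_sq_apply_le {A : QMat d} (hA : A.PosSemidef) (i j : Fin (2 ^ d)) :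
    ‖A i j‖ ^ 2 ≤ (A i i).re * (A j j).re := by
  have hd := (hA.submatrix ![i, j]).det_nonneg
  have hi : (A i i) = ((A i i).re : ℂ) :=
    (Complex.conj_eq_iff_re.1 (hA.isHermitian.apply i i)).symm
  have hj : (A j j) = ((A j j).re : ℂ) :=
    (Complex.conj_eq_iff_re.1 (hA.isHermitian.apply j j)).symm
  rw [Matrix.det_fin_two] at hd
  simp only [Matrix.submatrix_apply, Matrix.cons_val_zero, Matrix.cons_val_one] at hd
  rw [← hA.isHermitian.apply j i, Complex.star_def, Complex.mul_conj', hi, hj] at hd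
  have : (0 : ℝ) ≤ (A i i).re * (A j j).re - ‖A i j‖ ^ 2 := by exact_mod_cast hd
  linarith

lemma sum_re_diag {A : QMat d} (hA : A ∈ spectraplex d) : ∑ i, (A i i).re = 1 := by
  have := congrArg Complex.re hA.2
  simpa [Matrix.trace, Complex.re_sum] using this

/-- Summing the `2 × 2` minor inequalities gives `tr A² ≤ (tr A)²` without any spectral
decomposition. -/
lemma hsInner_self_le_one {A : QMat d} (hA : A ∈ spectraplex d) : hsInner A A ≤ 1 := by
  rw [hsInner_self]
  calc ∑ i, ∑ j, ‖A i j‖ ^ 2 ≤ ∑ i, ∑ j, (A i i).re * (A j j).re :=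
        Finset.sum_le_sum fun i _ => Finset.sum_le_sum fun j _ => norm_sq_apply_le hA.1 i j
    _ = 1 := by rw [← Finset.sum_mul_sum, sum_re_diag hA, one_mul]

lemma isClosed_spectraplex (d : ℕ) : IsClosed (spectraplex d) := by
  have h : spectraplex d = {A | A.conjTranspose = A} ∩
      (⋂ x : Fin (2 ^ d) → ℂ, {A | 0 ≤ star x ⬝ᵥ A.mulVec x}) ∩ {A | A.trace = 1} := by
    ext A
    simp [spectraplex, Matrix.posSemidef_iff_dotProduct_mulVec, Matrix.IsHermitian]
  rw [h]
  refine (IsClosed.inter (isClosed_eq (by fun_prop) (by fun_prop))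
    (isClosed_iInter fun x => ?_)).inter (isClosed_eq (by fun_prop) (by fun_prop))
  exact isClosed_le continuous_const (by fun_prop)

lemma isCompact_spectraplex (d : ℕ) : IsCompact (spectraplex d) :=
  (isCompact_hsBall d).of_isClosed_subset (isClosed_spectraplex d) fun _ => hsInner_self_le_one

lemma spectraplex_nonempty (d : ℕ) : (spectraplex d).Nonempty := by
  refine ⟨((2 : ℝ) ^ d)⁻¹ • 1, Matrix.PosSemidef.one.smul (by positivity), ?_⟩
  rw [Matrix.trace_smul, Matrix.trace_one]
  simp

lemma convex_jointStates (a b : ℕ) : Convex ℝ (jointStates a b) :=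
  (convex_spectraplex a).prod (convex_spectraplex b)

lemma jointStates_nonempty (a b : ℕ) : (jointStates a b).Nonempty :=
  (spectraplex_nonempty a).prod (spectraplex_nonempty b)

lemma isCompact_jointStates (a b : ℕ) : IsCompact (jointStates a b) :=
  (isCompact_spectraplex a).prod (isCompact_spectraplex b)

lemma jointStates_subset_jointHermitian (a b : ℕ) : jointStates a b ⊆ jointHermitian a b :=
  fun _ hz => ⟨hz.1.1.isHermitian, hz.2.1.isHermitian⟩

lemma jointHermitian_sub {z w : JointMat a b} (hz : z ∈ jointHermitian a b)
    (hw : w ∈ jointHermitian a b) : z - w ∈ jointHermitian a b :=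
  ⟨hz.1.sub hw.1, hz.2.sub hw.2⟩

lemma jointHermitian_smul {z : JointMat a b} (t : ℝ) (hz : z ∈ jointHermitian a b) :
    t • z ∈ jointHermitian a b := by
  constructor
  · rw [Prod.smul_fst, Matrix.IsHermitian, Matrix.conjTranspose_smul, hz.1]; simp
  · rw [Prod.smul_snd, Matrix.IsHermitian, Matrix.conjTranspose_smul, hz.2]; simp

lemma jointNorm_le_sqrt_two {z : JointMat a b} (hz : z ∈ jointStates a b) :
    jointNorm z ≤ √2 :=
  Real.sqrt_le_sqrt <| by
    have := hsInner_self_le_one hz.1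
    have := hsInner_self_le_one hz.2
    rw [jointInner]; linarith

/-- The squared distance of two joint states is at most `8`. -/
lemma jointForm_sub_le {z w : JointMat a b} (hz : z ∈ jointStates a b) (hw : w ∈ jointStates a b) :
    jointForm a b (z - w) (z - w) ≤ 8 := by
  have h1 := hsInner_self_le_one hz.1
  have h2 := hsInner_self_le_one hz.2
  have h3 := hsInner_self_le_one hw.1
  have h4 := hsInner_self_le_one hw.2
  -- Parallelogram law with `‖z + w‖²` dropped: `‖z - w‖² ≤ 2 ‖z‖² + 2 ‖w‖²`. The constant is not
  -- sharp, but it only enters `C`.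
  have h5 := jointForm_self_nonneg (z + w)
  simp only [map_add, LinearMap.add_apply, jointForm_comm w z] at h5
  simp only [map_sub, LinearMap.sub_apply, jointForm_comm w z]
  simp only [← jointInner_eq, jointInner] at h5 ⊢
  linarith

end Spectraplex

/-! ### The skew saddle form, its norm, and the duality gap as its maximum. -/

namespace QuantumGame

section Saddle

variable {a b : ℕ} {Ω : Type*} [Fintype Ω] (G : QuantumGame a b Ω)

lemma payoff_add_left (α α' : QMat a) (β : QMat b) :
    G.payoff (α + α') β = G.payoff α β + G.payoff α' β := by
  simp [payoff, Matrix.add_kronecker, mul_add]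

lemma payoff_add_right (α : QMat a) (β β' : QMat b) :
    G.payoff α (β + β') = G.payoff α β + G.payoff α β' := by
  simp [payoff, Matrix.kronecker_add, mul_add]

lemma payoff_smul_left (t : ℝ) (α : QMat a) (β : QMat b) :
    G.payoff (t • α) β = t * G.payoff α β := by
  simp [payoff, Matrix.smul_kronecker]

lemma payoff_smul_right (t : ℝ) (α : QMat a) (β : QMat b) :
    G.payoff α (t • β) = t * G.payoff α β := by
  simp [payoff, Matrix.kronecker_smul]

/-- The skew-symmetric bilinear form `payoff α β' - payoff α' β` in `(α', β')` and `(α, β)`. -/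
def saddleForm : LinearMap.BilinForm ℝ (JointMat a b) :=
  LinearMap.mk₂ ℝ (fun w z => G.payoff z.1 w.2 - G.payoff w.1 z.2)
    (fun x y z => by
      simp only [Prod.fst_add, Prod.snd_add, payoff_add_left, payoff_add_right]; ring)
    (fun t x y => by
      simp only [Prod.smul_fst, Prod.smul_snd, payoff_smul_left, payoff_smul_right, smul_eq_mul]
      ring)
    (fun x y z => by
      simp only [Prod.fst_add, Prod.snd_add, payoff_add_left, payoff_add_right]; ring)
    (fun t x y => by
      simp only [Prod.smul_fst, Prod.smul_snd, payoff_smul_left, payoff_smul_right, smul_eq_mul]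
      ring)

lemma saddleForm_apply (w z : JointMat a b) :
    G.saddleForm w z = G.payoff z.1 w.2 - G.payoff w.1 z.2 := rfl

lemma saddleForm_self (z : JointMat a b) : G.saddleForm z z = 0 := by
  rw [saddleForm_apply, sub_self]

lemma saddleForm_swap (w z : JointMat a b) : G.saddleForm z w = -G.saddleForm w z := by
  rw [saddleForm_apply, saddleForm_apply, neg_sub]

lemma trace_superop_mul (α : QMat a) (β : QMat b) :
    (G.superop β * α).trace = (G.observable.conjTranspose * (α ⊗ₖ β)).trace := by
  simp only [superop, Matrix.trace, Matrix.diag, Matrix.mul_apply, Matrix.of_apply,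
    Matrix.kroneckerMap_apply, Fintype.sum_prod_type, Matrix.one_apply, ite_mul, one_mul, zero_mul,
    mul_ite, mul_zero, Finset.sum_mul]
  refine Finset.sum_congr rfl fun i _ => ?_
  rw [Finset.sum_comm]
  refine Finset.sum_congr rfl fun k _ => Finset.sum_congr rfl fun j _ => ?_
  rw [Finset.sum_eq_single j]
  · refine Finset.sum_congr rfl fun l _ => ?_
    simp; ring
  · intro j' _ hj; simp [hj]
  · simp

lemma trace_superopAdj_mul (α : QMat a) (β : QMat b) :
    (G.superopAdj α * β).trace = (G.observable.conjTranspose * (α ⊗ₖ β)).trace := by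
  simp only [superopAdj, Matrix.trace, Matrix.diag, Matrix.mul_apply, Matrix.of_apply,
    Matrix.kroneckerMap_apply, Fintype.sum_prod_type, Matrix.one_apply, ite_mul, zero_mul,
    mul_ite, mul_one, mul_zero, Finset.sum_mul]
  rw [Finset.sum_comm (s := (Finset.univ : Finset (Fin (2 ^ a))))]
  refine Finset.sum_congr rfl fun i _ => ?_
  rw [Finset.sum_comm]
  refine Finset.sum_congr rfl fun k _ => ?_
  rw [Finset.sum_comm]
  refine Finset.sum_congr rfl fun p _ => Finset.sum_congr rfl fun j _ => ?_
  rw [Finset.sum_eq_single j]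
  · simp; ring
  · intro j' _ hj; simp [hj]
  · simp

lemma hsInner_eq_re_trace_mul {d : ℕ} (A : QMat d) {B : QMat d} (hB : B.IsHermitian) :
    hsInner A B = (A * B).trace.re := by
  rw [hsInner_comm, hsInner, hB, Matrix.trace_mul_comm]

/-- The partial trace is dual to tensoring with the identity. `hsInner` conjugates its first
argument; by symmetry the conjugate moves to the Hermitian `z`, so nothing need be known about the
adjoint of `grad w`. -/
lemma jointForm_grad (w : JointMat a b) {z : JointMat a b} (hz : z ∈ jointHermitian a b) :
    jointForm a b (G.grad w) z = G.saddleForm w z := by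
  rw [← jointInner_eq, jointInner, hsInner_eq_re_trace_mul _ hz.1, hsInner_eq_re_trace_mul _ hz.2,
    grad, trace_superop_mul, neg_mul, Matrix.trace_neg, trace_superopAdj_mul, Complex.neg_re,
    saddleForm_apply, payoff, payoff, sub_eq_add_neg]

lemma continuous_payoff {X : Type*} [TopologicalSpace X] {f : X → QMat a} {g : X → QMat b}
    (hf : Continuous f) (hg : Continuous g) : Continuous fun x => G.payoff (f x) (g x) := by
  simp only [payoff]
  refine Complex.continuous_re.comp (Continuous.matrix_trace (continuous_const.matrix_mul ?_))
  refine continuous_matrix fun i j => ?_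
  simp only [Matrix.kroneckerMap_apply]
  exact (hf.matrix_elem _ _).mul (hg.matrix_elem _ _)

lemma continuous_saddleForm {X : Type*} [TopologicalSpace X] {f g : X → JointMat a b}
    (hf : Continuous f) (hg : Continuous g) : Continuous fun x => G.saddleForm (f x) (g x) :=
  (G.continuous_payoff hg.fst hf.snd).sub (G.continuous_payoff hf.fst hg.snd)

lemma bddAbove_opNorm : BddAbove {t | ∃ z ∈ jointHermitian a b, ∃ w ∈ jointHermitian a b,
    jointNorm z = 1 ∧ jointNorm w = 1 ∧ t = jointInner (G.grad z) w} := by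
  have h := ((isCompact_jointHermitian_unitSphere a b).prod
    (isCompact_jointHermitian_unitSphere a b)).bddAbove_image
    (G.continuous_saddleForm continuous_fst continuous_snd).continuousOn
  refine h.mono ?_
  rintro t ⟨z, hz, w, hw, hz1, hw1, rfl⟩
  exact ⟨(z, w), ⟨⟨hz, hz1⟩, hw, hw1⟩, (G.jointForm_grad z hw).symm⟩

lemma saddleForm_le {z w : JointMat a b} (hw : w ∈ jointHermitian a b)
    (hz : z ∈ jointHermitian a b) :
    G.saddleForm w z ≤ G.opNorm * jointNorm w * jointNorm z := by
  rcases eq_or_ne w 0 with rfl | hw0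
  · simp [jointNorm_zero]
  rcases eq_or_ne z 0 with rfl | hz0
  · simp [jointNorm_zero]
  have hw' := jointNorm_pos hw0
  have hz' := jointNorm_pos hz0
  have h1 := jointHermitian_smul (jointNorm w)⁻¹ hw
  have h2 := jointHermitian_smul (jointNorm z)⁻¹ hz
  have h := le_csSup G.bddAbove_opNorm ⟨_, h1, _, h2,
    by rw [jointNorm_smul, abs_of_pos (inv_pos.2 hw'), inv_mul_cancel₀ hw'.ne'],
    by rw [jointNorm_smul, abs_of_pos (inv_pos.2 hz'), inv_mul_cancel₀ hz'.ne'], rfl⟩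
  rw [jointInner_eq, jointForm_grad _ _ h2, map_smul, map_smul, LinearMap.smul_apply,
    smul_eq_mul, smul_eq_mul] at h
  change _ ≤ G.opNorm at h
  rw [inv_mul_le_iff₀ hz', inv_mul_le_iff₀ hw'] at h
  linarith

/-- The duality gap at `z` is the maximum of the saddle form over the first argument. -/
lemma isGreatest_gap (z : JointMat a b) :
    IsGreatest ((fun w => G.saddleForm w z) '' jointStates a b) (G.gap z) := by
  obtain ⟨β, hβ, hβ'⟩ := (isCompact_spectraplex b).exists_sSup_image_eq (spectraplex_nonempty b)
    (G.continuous_payoff (continuous_const (y := z.1)) continuous_id).continuousOn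
  obtain ⟨α, hα, hα'⟩ := (isCompact_spectraplex a).exists_sInf_image_eq (spectraplex_nonempty a)
    (G.continuous_payoff continuous_id (continuous_const (y := z.2))).continuousOn
  have hb := ((isCompact_spectraplex b).image
    (G.continuous_payoff (continuous_const (y := z.1)) continuous_id)).bddAbove
  have ha := ((isCompact_spectraplex a).image
    (G.continuous_payoff continuous_id (continuous_const (y := z.2)))).bddBelow
  refine ⟨⟨(α, β), ⟨hα, hβ⟩, ?_⟩, ?_⟩
  · exact congrArg₂ (· - ·) hβ'.symm hα'.symm
  · rintro _ ⟨w, hw, rfl⟩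
    exact sub_le_sub (le_csSup hb ⟨w.2, hw.2, rfl⟩) (csInf_le ha ⟨w.1, hw.1, rfl⟩)

lemma saddleForm_le_gap {w : JointMat a b} (hw : w ∈ jointStates a b) (z : JointMat a b) :
    G.saddleForm w z ≤ G.gap z := (G.isGreatest_gap z).2 ⟨w, hw, rfl⟩

lemma exists_gap_eq (z : JointMat a b) : ∃ w ∈ jointStates a b, G.gap z = G.saddleForm w z := by
  obtain ⟨w, hw, h⟩ := (G.isGreatest_gap z).1
  exact ⟨w, hw, h.symm⟩

lemma gap_nonneg {z : JointMat a b} (hz : z ∈ jointStates a b) : 0 ≤ G.gap z :=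
  (G.saddleForm_self z).symm.trans_le (G.saddleForm_le_gap hz z)

lemma continuous_gap : Continuous G.gap := by
  have h : G.gap = fun z => sSup ((fun w => G.saddleForm w z) '' jointStates a b) :=
    funext fun z => (G.isGreatest_gap z).csSup_eq.symm
  rw [h]
  exact (isCompact_jointStates a b).continuous_sSup (f := fun z w => G.saddleForm w z)
    (G.continuous_saddleForm continuous_snd continuous_fst)

/-- The values in the supremum come in pairs `t, -t`, through `z ↦ -z`. -/
lemma opNorm_nonneg : 0 ≤ G.opNorm := by
  rcases Set.eq_empty_or_nonempty {t | ∃ z ∈ jointHermitian a b, ∃ w ∈ jointHermitian a b,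
    jointNorm z = 1 ∧ jointNorm w = 1 ∧ t = jointInner (G.grad z) w} with h | ⟨t, ht⟩
  · rw [opNorm, h, Real.sSup_empty]
  · have h1 := le_csSup G.bddAbove_opNorm ht
    obtain ⟨z, hz, w, hw, hz1, hw1, rfl⟩ := ht
    have h2 := le_csSup G.bddAbove_opNorm ⟨_, jointHermitian_smul (-1) hz, w, hw,
      by rw [jointNorm_smul, hz1]; norm_num, hw1, rfl⟩
    rw [jointInner_eq, jointForm_grad _ _ hw] at h1 h2
    rw [map_smul, LinearMap.smul_apply, smul_eq_mul] at h2
    rw [opNorm]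
    linarith

lemma gap_le_two_mul_opNorm {z : JointMat a b} (hz : z ∈ jointStates a b) :
    G.gap z ≤ 2 * G.opNorm := by
  obtain ⟨w, hw, h⟩ := G.exists_gap_eq z
  have h1 := G.saddleForm_le (jointStates_subset_jointHermitian a b hw)
    (jointStates_subset_jointHermitian a b hz)
  have h2 : jointNorm w * jointNorm z ≤ √2 * √2 :=
    mul_le_mul (jointNorm_le_sqrt_two hw) (jointNorm_le_sqrt_two hz) (jointNorm_nonneg z)
      (Real.sqrt_nonneg 2)
  rw [Real.mul_self_sqrt zero_le_two] at h2
  have h3 := mul_le_mul_of_nonneg_left h2 G.opNorm_nonneg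
  rw [h]; linarith

/-- A maximizer for `z` is a competitor for `z'`, and the difference is linear in `z - z'`; the
factor `√2` bounds the norm of the maximizer. -/
lemma gap_sub_le {z z' : JointMat a b} (hz : z ∈ jointStates a b) (hz' : z' ∈ jointStates a b) :
    G.gap z - G.gap z' ≤ √2 * G.opNorm * jointNorm (z - z') := by
  obtain ⟨w, hw, h⟩ := G.exists_gap_eq z
  have h1 := G.saddleForm_le (jointStates_subset_jointHermitian a b hw)
    (jointHermitian_sub (jointStates_subset_jointHermitian a b hz)
      (jointStates_subset_jointHermitian a b hz'))
  have h2 := G.saddleForm_le_gap hw z'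
  rw [map_sub] at h1
  have h3 := mul_le_mul_of_nonneg_left (jointNorm_le_sqrt_two hw)
    (mul_nonneg G.opNorm_nonneg (jointNorm_nonneg (z - z')))
  rw [h]; linarith

end Saddle

end QuantumGame

/-! ### First-order conditions and quadratic growth at constrained minimizers. -/

lemma nonneg_of_forall_mul_add_sq_mul {s c : ℝ}
    (h : ∀ t : ℝ, 0 < t → t ≤ 1 → 0 ≤ t * s + t ^ 2 * c) : 0 ≤ s := by
  by_contra! hs
  have hd : 0 < |c| + 1 := by positivity
  obtain ⟨t, ht0, ht⟩ := exists_between (lt_min one_pos (div_pos (neg_pos.2 hs) hd))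
  have h1 := h t ht0 (ht.le.trans (min_le_left _ _))
  have h2 := (lt_div_iff₀ hd).1 (ht.trans_le (min_le_right _ _))
  have h3 := le_abs_self c
  have h4 : 0 ≤ t * (s + t * c) := by linarith
  have h5 := nonneg_of_mul_nonneg_right h4 ht0
  nlinarith

section QuadraticGrowth

variable {a b : ℕ}

/-- A linear function plus a multiple of the squared distance to a point grows quadratically away
from its minimizer over a convex set. -/
lemma quadratic_growth {K : Set (JointMat a b)} (hK : Convex ℝ K) (l : JointMat a b →ₗ[ℝ] ℝ)
    (L : ℝ) (p : JointMat a b) {x y : JointMat a b} (hx : x ∈ K) (hy : y ∈ K)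
    (hmin : IsMinOn (fun z => l z + L / 2 * jointForm a b (z - p) (z - p)) K x) :
    l x + L / 2 * jointForm a b (x - p) (x - p) + L / 2 * jointForm a b (y - x) (y - x) ≤
      l y + L / 2 * jointForm a b (y - p) (y - p) := by
  -- Along the segment from `x` to `y` the objective is exactly a quadratic in `t`. Minimality makes
  -- its slope at `t = 0` nonnegative, and `t = 1` is then the claim; no sign of `L` is needed.
  have key : ∀ t : ℝ, l (x + t • (y - x)) +
      L / 2 * jointForm a b (x + t • (y - x) - p) (x + t • (y - x) - p) =
      l x + L / 2 * jointForm a b (x - p) (x - p) +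
        (t * (l (y - x) + L * jointForm a b (x - p) (y - x)) +
          t ^ 2 * (L / 2 * jointForm a b (y - x) (y - x))) := by
    intro t
    rw [show x + t • (y - x) - p = (x - p) + t • (y - x) by abel]
    generalize y - x = v
    generalize x - p = w
    simp only [map_add, map_smul, LinearMap.add_apply, LinearMap.smul_apply, smul_eq_mul,
      jointForm_comm v w]
    ring
  have hs := nonneg_of_forall_mul_add_sq_mul
    (s := l (y - x) + L * jointForm a b (x - p) (y - x))
    (c := L / 2 * jointForm a b (y - x) (y - x)) fun t ht0 ht1 => by
      have h := hmin (hK.add_smul_sub_mem hx hy ⟨ht0.le, ht1⟩)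
      simp only [Set.mem_ofPred_eq] at h
      rw [key] at h
      linarith
  have h1 := key 1
  rw [one_smul, add_sub_cancel] at h1
  linarith

lemma argminOn_spec {E : Type*} [TopologicalSpace E] [Nonempty E] {f : E → ℝ} {K : Set E}
    (hK : IsCompact K) (hne : K.Nonempty) (hf : Continuous f) :
    argminOn f K ∈ K ∧ IsMinOn f K (argminOn f K) :=
  Classical.epsilon_spec (hK.exists_isMinOn hne hf.continuousOn)

lemma argmaxOn_spec {E : Type*} [TopologicalSpace E] [Nonempty E] {f : E → ℝ} {K : Set E}
    (hK : IsCompact K) (hne : K.Nonempty) (hf : Continuous f) :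
    argmaxOn f K ∈ K ∧ IsMaxOn f K (argmaxOn f K) :=
  Classical.epsilon_spec (hK.exists_isMaxOn hne hf.continuousOn)

lemma regularizer_eq (zref z : JointMat a b) :
    regularizer zref z = jointForm a b (z - zref) (z - zref) / 2 := by
  rw [regularizer, jointNorm_sq]

lemma continuous_jointNorm_sub (p : JointMat a b) : Continuous fun z => jointNorm (z - p) :=
  continuous_jointNorm.comp (by fun_prop : Continuous fun z : JointMat a b => z - p)

lemma continuous_regularizer (zref : JointMat a b) : Continuous (regularizer zref) :=
  ((continuous_jointNorm_sub zref).pow 2).div_const 2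

lemma regularizer_nonneg (zref z : JointMat a b) : 0 ≤ regularizer zref z := by
  rw [regularizer]; positivity

lemma regularizer_le_regMax (zref : JointMat a b) {z : JointMat a b} (hz : z ∈ jointStates a b) :
    regularizer zref z ≤ regMax zref :=
  le_csSup ((isCompact_jointStates a b).image (continuous_regularizer zref)).bddAbove ⟨z, hz, rfl⟩

lemma regMax_le_four {zref : JointMat a b} (h : zref ∈ jointStates a b) : regMax zref ≤ 4 := by
  refine csSup_le ((jointStates_nonempty a b).image _) ?_
  rintro _ ⟨z, hz, rfl⟩
  rw [regularizer_eq]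
  linarith [jointForm_sub_le hz h]

lemma regMax_nonneg (zref : JointMat a b) : 0 ≤ regMax zref := by
  obtain ⟨z, hz⟩ := jointStates_nonempty a b
  exact (regularizer_nonneg zref z).trans (regularizer_le_regMax zref hz)

end QuadraticGrowth

/-! ### The smoothed gap: approximation, linear lower bound, quadratic upper bound. -/

namespace QuantumGame

section Smoothed

variable {a b : ℕ} {Ω : Type*} [Fintype Ω] (G : QuantumGame a b Ω) (zref : JointMat a b) (μ : ℝ)

/-- The smoothed duality gap `max_{z'} {payoff α β' - payoff α' β - μ r(z')}`. -/
def smoothedGap (z : JointMat a b) : ℝ :=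
  G.saddleForm (G.smoothedMaximizer zref μ z) z -
    μ * regularizer zref (G.smoothedMaximizer zref μ z)

lemma smoothedMaximizer_spec (z : JointMat a b) :
    G.smoothedMaximizer zref μ z ∈ jointStates a b ∧
      IsMaxOn (fun w => G.saddleForm w z - μ * regularizer zref w) (jointStates a b)
        (G.smoothedMaximizer zref μ z) :=
  argmaxOn_spec (isCompact_jointStates a b) (jointStates_nonempty a b)
    ((G.continuous_saddleForm continuous_id continuous_const).sub
      (continuous_const.mul (continuous_regularizer zref)))

lemma smoothedMaximizer_mem (z : JointMat a b) :
    G.smoothedMaximizer zref μ z ∈ jointStates a b := (G.smoothedMaximizer_spec zref μ z).1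

lemma le_smoothedGap {w : JointMat a b} (hw : w ∈ jointStates a b) (z : JointMat a b) :
    G.saddleForm w z - μ * regularizer zref w ≤ G.smoothedGap zref μ z :=
  (G.smoothedMaximizer_spec zref μ z).2 hw

/-- The maximizer at `u` remains a competitor at `y`, so it defines a subgradient. -/
lemma smoothedGap_lower (u y : JointMat a b) :
    G.smoothedGap zref μ u + G.saddleForm (G.smoothedMaximizer zref μ u) (y - u) ≤
      G.smoothedGap zref μ y := by
  have h := G.le_smoothedGap zref μ (G.smoothedMaximizer_mem zref μ u) y
  rw [map_sub, smoothedGap]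
  linarith

variable {μ}

/-- The smoothed duality gap is strongly concave in the maximization variable. -/
lemma saddleForm_sub_add_le_smoothedGap {w : JointMat a b} (hw : w ∈ jointStates a b)
    (z : JointMat a b) :
    G.saddleForm w z - μ * regularizer zref w + μ / 2 *
        jointNorm (w - G.smoothedMaximizer zref μ z) ^ 2 ≤ G.smoothedGap zref μ z := by
  obtain ⟨hm, hmax⟩ := G.smoothedMaximizer_spec zref μ z
  -- Skew-symmetry turns the maximization into minimizing `saddleForm z` plus `μ` times the
  -- regularizer.
  have h := quadratic_growth (convex_jointStates a b) (G.saddleForm z) μ zref hm hw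
    fun y hy => by
      have := hmax hy
      simp only [Set.mem_ofPred_eq, regularizer_eq] at this
      simp only [Set.mem_ofPred_eq]
      rw [G.saddleForm_swap y, G.saddleForm_swap (G.smoothedMaximizer zref μ z)]
      linarith
  rw [G.saddleForm_swap w, G.saddleForm_swap (G.smoothedMaximizer zref μ z)] at h
  rw [smoothedGap, jointNorm_sq, regularizer_eq, regularizer_eq]
  linarith

/-- At `u`, the maximizer for `y` loses `μ/2` times the squared distance `s²` between the two
maximizers. This loss pays for the cross term `‖F‖ s ‖y - u‖` up to `‖F‖² / (2 μ) ‖y - u‖²`, by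
completing the square. -/
lemma smoothedGap_upper (hμ : 0 < μ) {u y : JointMat a b} (hu : u ∈ jointStates a b)
    (hy : y ∈ jointStates a b) :
    G.smoothedGap zref μ y ≤ G.smoothedGap zref μ u +
      G.saddleForm (G.smoothedMaximizer zref μ u) (y - u) +
        G.opNorm ^ 2 / μ / 2 * jointNorm (y - u) ^ 2 := by
  have hw := G.smoothedMaximizer_mem zref μ y
  have h1 := G.saddleForm_sub_add_le_smoothedGap zref hw u (μ := μ)
  have hH := jointStates_subset_jointHermitian a b
  have h2 := G.saddleForm_le (jointHermitian_sub (hH hw) (hH (G.smoothedMaximizer_mem zref μ u)))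
    (jointHermitian_sub (hH hy) (hH hu))
  rw [smoothedGap]
  have h3 : G.saddleForm (G.smoothedMaximizer zref μ y) y =
      G.saddleForm (G.smoothedMaximizer zref μ y) u +
        (G.saddleForm (G.smoothedMaximizer zref μ u) (y - u) +
          G.saddleForm (G.smoothedMaximizer zref μ y - G.smoothedMaximizer zref μ u) (y - u)) := by
    simp only [map_sub, LinearMap.sub_apply]; ring
  have h4 : G.opNorm * jointNorm (G.smoothedMaximizer zref μ y - G.smoothedMaximizer zref μ u) *
      jointNorm (y - u) ≤
      μ / 2 * jointNorm (G.smoothedMaximizer zref μ y - G.smoothedMaximizer zref μ u) ^ 2 +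
        G.opNorm ^ 2 / μ / 2 * jointNorm (y - u) ^ 2 := by
    generalize jointNorm (G.smoothedMaximizer zref μ y - G.smoothedMaximizer zref μ u) = s
    generalize jointNorm (y - u) = t
    have : μ / 2 * s ^ 2 + G.opNorm ^ 2 / μ / 2 * t ^ 2 - G.opNorm * s * t =
        (μ * s - G.opNorm * t) ^ 2 / (2 * μ) := by field_simp; ring
    have h : 0 ≤ (μ * s - G.opNorm * t) ^ 2 / (2 * μ) := by positivity
    linarith
  linarith

lemma smoothedGap_le_gap (hμ : 0 ≤ μ) (z : JointMat a b) :
    G.smoothedGap zref μ z ≤ G.gap z := by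
  have h1 := G.saddleForm_le_gap (G.smoothedMaximizer_mem zref μ z) z
  have h2 := mul_nonneg hμ (regularizer_nonneg zref (G.smoothedMaximizer zref μ z))
  rw [smoothedGap]; linarith

lemma gap_le_smoothedGap_add (hμ : 0 ≤ μ) (z : JointMat a b) :
    G.gap z ≤ G.smoothedGap zref μ z + μ * regMax zref := by
  obtain ⟨w, hw, h⟩ := G.exists_gap_eq z
  have h1 := G.le_smoothedGap zref μ hw z
  have h2 := mul_le_mul_of_nonneg_left (regularizer_le_regMax zref hw) hμ
  linarith

lemma continuous_smoothedGap : Continuous (G.smoothedGap zref μ) := by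
  have h : G.smoothedGap zref μ = fun z =>
      sSup ((fun w => G.saddleForm w z - μ * regularizer zref w) '' jointStates a b) := by
    funext z
    have hg : IsGreatest ((fun w => G.saddleForm w z - μ * regularizer zref w) '' jointStates a b)
        (G.smoothedGap zref μ z) := by
      refine ⟨⟨_, G.smoothedMaximizer_mem zref μ z, rfl⟩, ?_⟩
      rintro _ ⟨w, hw, rfl⟩
      exact G.le_smoothedGap zref μ hw z
    exact hg.csSup_eq.symm
  rw [h]
  exact (isCompact_jointStates a b).continuous_sSup
    (f := fun z w => G.saddleForm w z - μ * regularizer zref w)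
    ((G.continuous_saddleForm continuous_snd continuous_fst).sub
      (continuous_const.mul ((continuous_regularizer zref).comp continuous_snd)))

/-- The smoothed duality gap takes a nonpositive value: at a minimizer `z`, the first-order
condition in the direction of the maximizer `w` reads `B(w, z) ≤ B(w, w) = 0`. -/
lemma exists_smoothedGap_nonpos (hμ : 0 < μ) :
    ∃ z ∈ jointStates a b, G.smoothedGap zref μ z ≤ 0 := by
  obtain ⟨z, hz, hmin⟩ := (isCompact_jointStates a b).exists_isMinOn (jointStates_nonempty a b)
    (G.continuous_smoothedGap zref (μ := μ)).continuousOn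
  refine ⟨z, hz, ?_⟩
  have hw := G.smoothedMaximizer_mem zref μ z
  have hs : 0 ≤ G.saddleForm (G.smoothedMaximizer zref μ z) (G.smoothedMaximizer zref μ z - z) := by
    -- Move from `z` towards the maximizer: the quadratic upper bound plays the role of
    -- differentiability.
    refine nonneg_of_forall_mul_add_sq_mul (c := G.opNorm ^ 2 / μ / 2 *
      jointNorm (G.smoothedMaximizer zref μ z - z) ^ 2) fun t ht0 ht1 => ?_
    have hy := (convex_jointStates a b).add_smul_sub_mem hz hw ⟨ht0.le, ht1⟩
    have h1 : G.smoothedGap zref μ z ≤ _ := hmin hy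
    have h2 := G.smoothedGap_upper zref hμ hz hy
    rw [add_sub_cancel_left, jointNorm_smul, map_smul, smul_eq_mul, mul_pow, sq_abs] at h2
    linarith
  have h2 := mul_nonneg hμ.le (regularizer_nonneg zref (G.smoothedMaximizer zref μ z))
  rw [map_sub, saddleForm_self] at hs
  rw [smoothedGap]
  linarith

end Smoothed

/-! ### Minimax theorem, distance to the optimal states, and the error-bound modulus. -/

section Optimal

variable {a b : ℕ} {Ω : Type*} [Fintype Ω] (G : QuantumGame a b Ω)

lemma opt_nonempty : G.opt.Nonempty :=
  (isCompact_jointStates a b).exists_isMinOn (jointStates_nonempty a b)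
    G.continuous_gap.continuousOn

/-- The minimax theorem: the duality gap of an optimal joint state vanishes. -/
lemma gap_eq_zero_of_mem_opt {z : JointMat a b} (hz : z ∈ G.opt) : G.gap z = 0 := by
  refine le_antisymm (le_of_forall_pos_le_add fun η hη => ?_) (G.gap_nonneg hz.1)
  -- Any reference point would do; `μ = η / (D + 1)` makes the smoothing error at most `η`, even
  -- when `D = 0`.
  have hD : 0 < regMax z + 1 := by linarith [regMax_nonneg z]
  obtain ⟨y, hy, h⟩ := G.exists_smoothedGap_nonpos z (μ := η / (regMax z + 1)) (by positivity)
  have h1 : G.gap z ≤ G.gap y := hz.2 hy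
  have h2 := G.gap_le_smoothedGap_add z (μ := η / (regMax z + 1)) (by positivity) y
  have h3 : η / (regMax z + 1) * regMax z ≤ η := by
    rw [div_mul_eq_mul_div, div_le_iff₀ hD]; linarith
  linarith

lemma mem_opt_iff {z : JointMat a b} : z ∈ G.opt ↔ z ∈ jointStates a b ∧ G.gap z = 0 := by
  refine ⟨fun h => ⟨h.1, G.gap_eq_zero_of_mem_opt h⟩, fun h => ⟨h.1, fun y hy => ?_⟩⟩
  simpa [h.2] using G.gap_nonneg hy

lemma isCompact_opt : IsCompact G.opt := by
  have h : G.opt = jointStates a b ∩ {z | G.gap z = 0} := by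
    ext z; exact G.mem_opt_iff
  rw [h]
  exact (isCompact_jointStates a b).inter_right (isClosed_eq G.continuous_gap continuous_const)

lemma exists_dist_eq (z : JointMat a b) : ∃ w ∈ G.opt, G.dist z = jointNorm (z - w) := by
  have hc : Continuous fun w => jointNorm (z - w) :=
    continuous_jointNorm.comp (by fun_prop : Continuous fun w : JointMat a b => z - w)
  exact G.isCompact_opt.exists_sInf_image_eq G.opt_nonempty hc.continuousOn

lemma dist_nonneg (z : JointMat a b) : 0 ≤ G.dist z := by
  obtain ⟨w, -, h⟩ := G.exists_dist_eq z
  exact h ▸ jointNorm_nonneg _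

lemma gap_le_mul_dist {z : JointMat a b} (hz : z ∈ jointStates a b) :
    G.gap z ≤ √2 * G.opNorm * G.dist z := by
  obtain ⟨w, hw, h⟩ := G.exists_dist_eq z
  have h1 := G.gap_sub_le hz hw.1
  rw [G.gap_eq_zero_of_mem_opt hw, sub_zero] at h1
  exact h ▸ h1

/-- The error bound passes to the supremum. The multiplicative form in `ℝ≥0∞` also covers the moduli
`0` and `∞`. -/
lemma modulus_mul_dist_le {z : JointMat a b} (hz : z ∈ jointStates a b) :
    G.modulus * ENNReal.ofReal (G.dist z) ≤ ENNReal.ofReal (G.gap z) := by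
  simp only [modulus, ENNReal.iSup_mul]
  refine iSup₂_le fun d hd => ?_
  rw [← ENNReal.ofReal_mul hd.1.le, mul_comm]
  exact ENNReal.ofReal_le_ofReal ((le_div_iff₀ hd.1).1 (hd.2 z hz))

/-- The error-bound modulus of a game with a joint state of positive duality gap is finite, and at
most `√2` times the operator norm. -/
lemma modulus_le {z : JointMat a b} (hz : z ∈ jointStates a b) (hpos : 0 < G.gap z) :
    G.modulus ≤ ENNReal.ofReal (√2 * G.opNorm) := by
  have h1 := G.gap_le_mul_dist hz
  have hd : 0 < G.dist z := (G.dist_nonneg z).lt_of_ne fun h => by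
    rw [← h, mul_zero] at h1; linarith
  refine iSup₂_le fun d hd' => ENNReal.ofReal_le_ofReal ?_
  have h2 := (le_div_iff₀ hd'.1).1 (hd'.2 z hz)
  nlinarith

lemma opNorm_pos {z : JointMat a b} (hz : z ∈ jointStates a b) (hpos : 0 < G.gap z) :
    0 < G.opNorm := by
  linarith [G.gap_le_two_mul_opNorm hz]

/-- If `D = 0`, then `zref` is the only possible joint state and the gap vanishes by skew-symmetry.
Positivity keeps `e / (2 D)` from being a division by zero. -/
lemma regMax_pos (zref : JointMat a b) {z : JointMat a b} (hpos : 0 < G.gap z)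
    (hz : z ∈ jointStates a b) : 0 < regMax zref := by
  refine (regMax_nonneg zref).lt_of_ne fun h0 => ?_
  have h : ∀ y ∈ jointStates a b, y = zref := fun y hy => by
    have h1 := regularizer_le_regMax zref hy
    rw [← h0, regularizer_eq] at h1
    have h2 := jointForm_self_nonneg (y - zref)
    exact sub_eq_zero.1 (eq_zero_of_jointForm_self (by linarith))
  obtain ⟨w, hw, hg⟩ := G.exists_gap_eq z
  rw [h w hw, h z hz, saddleForm_self] at hg
  rw [h z hz] at hpos
  linarith

end Optimal

end QuantumGame

/-! ### Convergence rate of the accelerated method. -/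

namespace QuantumGame

section Acceleration

variable {a b : ℕ} {Ω : Type*} [Fintype Ω] (G : QuantumGame a b Ω) (zref : JointMat a b) (e : ℝ)
  (z₀ : JointMat a b)

/-- The invariant of the accelerated method after `k` steps: the estimate function given by the
dual-averaging objective lies below the weighted smoothed gap plus the prox term, and, up to
quadratic growth around the dual-averaging point, above the weighted smoothed gap of the iterate. -/
def EstimateInvariant (k : ℕ) (s : SmoothingState a b) : Prop :=
  s.iterate ∈ jointStates a b ∧ s.dual ∈ jointStates a b ∧ ∃ c : ℝ,
    (∀ y ∈ jointStates a b, jointForm a b s.gradSum y + c ≤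
      (k : ℝ) * (k + 1) / 4 * G.smoothedGap zref (smoothingParam zref e) y) ∧
    ∀ x ∈ jointStates a b,
      (k : ℝ) * (k + 1) / 4 * G.smoothedGap zref (smoothingParam zref e) s.iterate +
          G.lipConst zref e / 2 * jointForm a b (x - s.dual) (x - s.dual) ≤
        G.lipConst zref e / 2 * jointForm a b (x - z₀) (x - z₀) + jointForm a b s.gradSum x + c

variable {z₀}

lemma estimateInvariant_zero (hz₀ : z₀ ∈ jointStates a b) :
    G.EstimateInvariant zref e z₀ 0 ⟨z₀, z₀, 0⟩ :=
  ⟨hz₀, hz₀, 0, by simp, by simp⟩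

variable {e}

lemma EstimateInvariant.step (hμ : 0 < smoothingParam zref e)
    {k : ℕ} {s : SmoothingState a b} (h : G.EstimateInvariant zref e z₀ k s) :
    G.EstimateInvariant zref e z₀ (k + 1) (G.smoothingStep zref e z₀ k s) := by
  obtain ⟨hz, hw, c, hc1, hc2⟩ := h
  have hL : 0 ≤ G.lipConst zref e := by rw [lipConst]; positivity
  have hK := isCompact_jointStates a b
  have hne := jointStates_nonempty a b
  have hcv := convex_jointStates a b
  have hk2 : (0 : ℝ) < k + 2 := by positivity
  set u : JointMat a b := (2 / ((k : ℝ) + 2)) • s.dual + ((k : ℝ) / ((k : ℝ) + 2)) • s.iterate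
    with hu_def
  set m : JointMat a b := G.smoothedMaximizer zref (smoothingParam zref e) u
  set g : JointMat a b := G.grad m
  set gs : JointMat a b := s.gradSum + (((k : ℝ) + 1) / 2) • g with hgs_def
  set L : ℝ := G.lipConst zref e with hL_def
  have hu : u ∈ jointStates a b :=
    hcv hw hz (by positivity) (by positivity) (by field_simp; ring)
  have hg : ∀ y ∈ jointStates a b, ∀ y' ∈ jointStates a b,
      jointForm a b g (y - y') = G.saddleForm m (y - y') := fun y hy y' hy' =>
    G.jointForm_grad m (jointHermitian_sub (jointStates_subset_jointHermitian a b hy)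
      (jointStates_subset_jointHermitian a b hy'))
  obtain ⟨hz1, hz1min⟩ := argminOn_spec (f := fun y => jointInner g (y - u) +
    L / 2 * jointNorm (y - u) ^ 2) hK hne (by
      have h1 : Continuous fun y => jointForm a b g (y - u) :=
        continuous_jointForm continuous_const (by fun_prop)
      exact h1.add (continuous_const.mul ((continuous_jointNorm_sub u).pow 2)))
  obtain ⟨hw1, hw1min⟩ := argminOn_spec (f := fun y => jointInner gs y +
    L / 2 * jointNorm (y - z₀) ^ 2) hK hne (by
      have h1 : Continuous fun y => jointForm a b gs y :=
        continuous_jointForm continuous_const continuous_id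
      exact h1.add (continuous_const.mul ((continuous_jointNorm_sub z₀).pow 2)))
  have hstep : G.smoothingStep zref e z₀ k s =
    ⟨argminOn (fun y => jointInner g (y - u) + L / 2 * jointNorm (y - u) ^ 2) (jointStates a b),
      argminOn (fun y => jointInner gs y + L / 2 * jointNorm (y - z₀) ^ 2) (jointStates a b), gs⟩ :=
    rfl
  rw [hstep]
  generalize argminOn (fun y => jointInner g (y - u) + L / 2 * jointNorm (y - u) ^ 2)
    (jointStates a b) = z1 at hz1 hz1min ⊢
  generalize argminOn (fun y => jointInner gs y + L / 2 * jointNorm (y - z₀) ^ 2)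
    (jointStates a b) = w1 at hw1 hw1min ⊢
  set f := G.smoothedGap zref (smoothingParam zref e) with hf_def
  have hlow : ∀ y ∈ jointStates a b, f u + jointForm a b g (y - u) ≤ f y := fun y hy => by
    rw [hg y hy u hu]; exact G.smoothedGap_lower zref _ u y
  have hup : ∀ y ∈ jointStates a b, f z1 ≤ f u + jointForm a b g (y - u) +
      L / 2 * jointForm a b (y - u) (y - u) := fun y hy => by
    have h1 : f z1 ≤ _ := G.smoothedGap_upper zref hμ hu hz1
    have h2 := hz1min hy
    simp only [Set.mem_ofPred_eq, jointInner_eq, jointNorm_sq] at h2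
    rw [← hg z1 hz1 u hu, jointNorm_sq] at h1
    change f z1 ≤ f u + _ + L / 2 * _ at h1
    linarith
  -- The weights `A_k = k (k + 1) / 4` are the partial sums of the dual-averaging weights `(i + 1) /
  -- 2`.
  have hA : (k : ℝ) * (k + 1) / 4 + (k + 1) / 2 = (k + 1) * (k + 2) / 4 := by ring
  have hlower : ∀ x ∈ jointStates a b, ((k : ℝ) + 1) * (k + 2) / 4 * f z1 ≤
      L / 2 * jointForm a b (x - z₀) (x - z₀) + jointForm a b gs x +
        (c + (k + 1) / 2 * (f u - jointForm a b g u)) := by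
    intro x hx
    have h1 := hc2 x hx
    have h2 := mul_le_mul_of_nonneg_left (hlow _ hz) (by positivity : 0 ≤ (k : ℝ) * (k + 1) / 4)
    -- Test the quadratic model at the point built like `u` with `x` in place of the dual point, so
    -- that `y - u` is a multiple of `x - s.dual`.
    set y : JointMat a b := (2 / ((k : ℝ) + 2)) • x + ((k : ℝ) / ((k : ℝ) + 2)) • s.iterate
      with hy_def
    have hy : y ∈ jointStates a b := hcv hx hz (by positivity) (by positivity) (by field_simp; ring)
    have h3 := mul_le_mul_of_nonneg_left (hup y hy)
      (by positivity : 0 ≤ ((k : ℝ) + 1) * (k + 2) / 4)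
    have hyu : y - u = (2 / ((k : ℝ) + 2)) • (x - s.dual) := by
      rw [hy_def, hu_def, smul_sub]; abel
    have hgu : jointForm a b g u = 2 / ((k : ℝ) + 2) * jointForm a b g s.dual +
        (k : ℝ) / ((k : ℝ) + 2) * jointForm a b g s.iterate := by
      rw [hu_def, map_add, map_smul, map_smul, smul_eq_mul, smul_eq_mul]
    have hgs : jointForm a b gs x = jointForm a b s.gradSum x +
        (k + 1) / 2 * jointForm a b g x := by
      rw [hgs_def, map_add, LinearMap.add_apply, map_smul, LinearMap.smul_apply, smul_eq_mul]
    have hq := mul_nonneg hL (jointForm_self_nonneg (x - s.dual))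
    rw [hyu] at h3
    simp only [map_smul, LinearMap.smul_apply, smul_eq_mul] at h3
    rw [hgs]
    generalize jointForm a b (x - s.dual) (x - s.dual) = q at *
    rw [map_sub] at h2 h3
    have e1 : ((k : ℝ) + 1) * (k + 2) / 4 * (2 / (k + 2)) = (k + 1) / 2 := by field_simp; ring
    have e2 : ((k : ℝ) + 1) * (k + 2) / 4 * (k / (k + 2)) = k * (k + 1) / 4 := by field_simp
    -- This inequality fixes the admissible growth of the weights: the quadratic term of the model
    -- is at most the growth term `L / 2 ‖x - s.dual‖²` of the old invariant.
    have e3 : ((k : ℝ) + 1) / 2 * (2 / (k + 2)) ≤ 1 := by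
      rw [div_mul_div_comm, div_le_one (by positivity)]; linarith
    have h4 : ((k : ℝ) + 1) * (k + 2) / 4 * (f u + 2 / (k + 2) *
        (jointForm a b g x - jointForm a b g s.dual) + L / 2 * (2 / (k + 2) * (2 / (k + 2) * q))) =
        (k + 1) * (k + 2) / 4 * f u +
          (k + 1) / 2 * (jointForm a b g x - jointForm a b g s.dual) +
            ((k + 1) / 2 * (2 / (k + 2))) * (L * q / 2) := by
      rw [← e1]; ring
    have h5 : ((k : ℝ) + 1) * (k + 2) / 4 * jointForm a b g u =
        (k + 1) / 2 * jointForm a b g s.dual + k * (k + 1) / 4 * jointForm a b g s.iterate := by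
      rw [hgu, ← e1, ← e2]; ring
    have h6 := mul_le_mul_of_nonneg_right e3 (by positivity : 0 ≤ L * q / 2)
    rw [← hA] at h5
    rw [h4, ← hA] at h3
    rw [← hA]
    linarith
  -- The constant collects the affine parts of the weighted linearizations at the points `u`.
  refine ⟨hz1, hw1, c + (k + 1) / 2 * (f u - jointForm a b g u), fun y hy => ?_, fun x hx => ?_⟩
  · have h1 := hc1 y hy
    have h2 := mul_le_mul_of_nonneg_left (hlow y hy) (by positivity : 0 ≤ ((k : ℝ) + 1) / 2)
    rw [map_sub] at h2
    rw [hgs_def, map_add, LinearMap.add_apply, map_smul, LinearMap.smul_apply, smul_eq_mul]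
    push_cast
    linarith
  -- The lower bound is used only at the minimizer `w1` of the estimate function; quadratic growth
  -- around `w1` restores the invariant for all `x`.
  · have h1 := quadratic_growth hcv (jointForm a b gs) L z₀ hw1 hx fun y hy => by
      have := hw1min hy
      simpa only [Set.mem_ofPred_eq, jointInner_eq, jointNorm_sq] using this
    have h2 := hlower w1 hw1
    push_cast
    linarith

lemma estimateInvariant_smoothingState (hμ : 0 < smoothingParam zref e)
    (hz₀ : z₀ ∈ jointStates a b) (k : ℕ) :
    G.EstimateInvariant zref e z₀ k (G.smoothingState zref e z₀ k) := by
  induction k with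
  | zero => exact G.estimateInvariant_zero zref e hz₀
  | succ k ih => exact ih.step G zref hμ

/-- The convergence rate of the smoothing procedure. -/
lemma gap_smoothingState_le (he : 0 < e) (hD : 0 < regMax zref) (hz₀ : z₀ ∈ jointStates a b)
    {k : ℕ} (hk : 1 ≤ k) :
    G.gap (G.smoothingState zref e z₀ k).iterate ≤
      e / 2 + 4 * G.opNorm ^ 2 * regMax zref * G.dist z₀ ^ 2 / (e * (k * (k + 1))) := by
  have hμ : 0 < smoothingParam zref e := by rw [smoothingParam]; positivity
  have hk' : (0 : ℝ) < k := by exact_mod_cast hk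
  obtain ⟨hz, hw, c, hc1, hc2⟩ := G.estimateInvariant_smoothingState zref hμ hz₀ k
  obtain ⟨y, hy, hd⟩ := G.exists_dist_eq z₀
  have h1 := hc1 y hy.1
  have h2 := hc2 y hy.1
  have h3 := G.gap_le_smoothedGap_add zref hμ.le (G.smoothingState zref e z₀ k).iterate
  have h4 := G.smoothedGap_le_gap zref hμ.le y
  rw [G.gap_eq_zero_of_mem_opt hy] at h4
  have hL : 0 ≤ G.lipConst zref e := by rw [lipConst]; positivity
  have h5 := mul_nonneg hL (jointForm_self_nonneg (y - (G.smoothingState zref e z₀ k).dual))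
  have h6 : (k : ℝ) * (k + 1) / 4 * G.smoothedGap zref (smoothingParam zref e) y ≤ 0 :=
    mul_nonpos_of_nonneg_of_nonpos (by positivity) h4
  have h7 : jointForm a b (y - z₀) (y - z₀) = G.dist z₀ ^ 2 := by
    rw [hd, jointNorm_sq, ← neg_sub z₀ y, map_neg, map_neg, LinearMap.neg_apply, neg_neg]
  have h8 : smoothingParam zref e * regMax zref = e / 2 := by rw [smoothingParam]; field_simp
  have h9 : G.lipConst zref e = 2 * G.opNorm ^ 2 * regMax zref / e := by
    rw [lipConst, smoothingParam]; field_simp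
  have h10 : (k : ℝ) * (k + 1) / 4 *
      G.smoothedGap zref (smoothingParam zref e) (G.smoothingState zref e z₀ k).iterate ≤
      G.opNorm ^ 2 * regMax zref * G.dist z₀ ^ 2 / e := by
    rw [h7, h9] at h2
    have : 2 * G.opNorm ^ 2 * regMax zref / e / 2 * G.dist z₀ ^ 2 =
      G.opNorm ^ 2 * regMax zref * G.dist z₀ ^ 2 / e := by ring
    rw [h9] at h5
    linarith
  have h11 : G.smoothedGap zref (smoothingParam zref e) (G.smoothingState zref e z₀ k).iterate ≤
      4 * G.opNorm ^ 2 * regMax zref * G.dist z₀ ^ 2 / (e * (k * (k + 1))) := by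
    rw [le_div_iff₀ (by positivity)]
    rw [le_div_iff₀ he] at h10
    linarith
  linarith

end Acceleration

end QuantumGame

lemma ENat.ceil_ofReal {x : ℝ} (hx : 0 ≤ x) :
    ENat.ceil (ENNReal.ofReal x) = (⌈x⌉₊ : ℕ∞) := by
  lift x to NNReal using hx
  rw [ENNReal.ofReal_coe_nnreal, ENat.ceil_coe]
  exact congrArg _ (eq_of_forall_ge_iff fun n => by simp only [Nat.ceil_le]; norm_cast)

/-! ### Cost of a single call, the outer loop, and the total count. -/

namespace QuantumGame

section IterSmooth

variable {a b : ℕ} {Ω : Type*} [Fintype Ω] (G : QuantumGame a b Ω) (zref : JointMat a b)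

/-- The bound on the number of first-order iterations of one call of the smoothing procedure. -/
def callBound (γ : ℝ) : ℝ≥0∞ :=
  ENNReal.ofReal (2 * √2 * γ * G.opNorm * √(regMax zref)) / G.modulus

variable {e : ℝ} {z₀ : JointMat a b}

lemma iterate_mem (hμ : 0 < smoothingParam zref e) (hz₀ : z₀ ∈ jointStates a b) (k : ℕ) :
    (G.smoothingState zref e z₀ k).iterate ∈ jointStates a b :=
  (G.estimateInvariant_smoothingState zref hμ hz₀ k).1

/-- An iterate of small gap bounds the number of iterations of the smoothing procedure. -/
lemma exists_smoothingReturns_of_le {k₀ : ℕ} (hk₀ : 1 ≤ k₀)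
    (h : G.gap (G.smoothingState zref e z₀ k₀).iterate ≤ e) :
    ∃ k ≤ k₀, G.SmoothingReturns zref e z₀ k (G.smoothingState zref e z₀ k).iterate := by
  classical
  have hex : ∃ k, 1 ≤ k ∧ G.gap (G.smoothingState zref e z₀ k).iterate ≤ e := ⟨k₀, hk₀, h⟩
  refine ⟨Nat.find hex, Nat.find_le ⟨hk₀, h⟩, (Nat.find_spec hex).1, rfl, (Nat.find_spec hex).2,
    fun j hj1 hj => ?_⟩
  have := Nat.find_min hex hj
  push Not at this
  exact this hj1

/-- A quadratic lower bound on the iteration count that makes the gap at most `e`. -/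
lemma gap_smoothingState_le_of_le (he : 0 < e) (hD : 0 < regMax zref) (hz₀ : z₀ ∈ jointStates a b)
    {k : ℕ} (hk : 1 ≤ k)
    (h : 8 * G.opNorm ^ 2 * regMax zref * G.dist z₀ ^ 2 ≤ e ^ 2 * k ^ 2) :
    G.gap (G.smoothingState zref e z₀ k).iterate ≤ e := by
  have h1 := G.gap_smoothingState_le zref he hD hz₀ hk
  have hk' : (0 : ℝ) < k := by exact_mod_cast hk
  have h2 : 4 * G.opNorm ^ 2 * regMax zref * G.dist z₀ ^ 2 / (e * (k * (k + 1))) ≤ e / 2 := by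
    rw [div_le_iff₀ (by positivity)]
    have : 0 ≤ e ^ 2 * k := by positivity
    linarith
  linarith

/-- Termination without an error bound, for games of modulus `0`. -/
lemma exists_smoothingReturns (he : 0 < e) (hD : 0 < regMax zref) (hz₀ : z₀ ∈ jointStates a b) :
    ∃ k, G.SmoothingReturns zref e z₀ k (G.smoothingState zref e z₀ k).iterate := by
  obtain ⟨k, hk⟩ := exists_nat_ge (8 * G.opNorm ^ 2 * regMax zref * G.dist z₀ ^ 2 / e ^ 2)
  rw [div_le_iff₀ (by positivity)] at hk
  obtain ⟨j, -, h⟩ := G.exists_smoothingReturns_of_le zref (k₀ := k + 1) (by omega)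
    (G.gap_smoothingState_le_of_le zref he hD hz₀ (by omega) (hk.trans (by
      push_cast
      have : (0 : ℝ) ≤ k := k.cast_nonneg
      have h2 : 0 < e ^ 2 := by positivity
      nlinarith [mul_nonneg h2.le this, mul_nonneg (mul_nonneg h2.le this) this])))
  exact ⟨j, h⟩

/-- The error bound turns `gap z₀ ≤ γ e` into `dist z₀ ≤ γ e / δ`, which cancels `e` from the
iteration count. -/
lemma smoothingReturns_call {γ : ℝ} (hγ : 0 < γ) (he : 0 < e) (hz₀ : z₀ ∈ jointStates a b)
    (hpos : 0 < G.gap z₀) (hgap : G.gap z₀ ≤ γ * e) :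
    ∃ (k : ℕ) (z : JointMat a b), G.SmoothingReturns zref e z₀ k z ∧ z ∈ jointStates a b ∧
      (k : ℕ∞) ≤ ENat.ceil (G.callBound zref γ) := by
  have hD := G.regMax_pos zref hpos hz₀
  have hM := G.opNorm_pos hz₀ hpos
  have hμ : 0 < smoothingParam zref e := by rw [smoothingParam]; positivity
  have hnum : 0 < 2 * √2 * γ * G.opNorm * √(regMax zref) := by positivity
  rcases eq_or_ne G.modulus 0 with h0 | h0
  · obtain ⟨k, hk⟩ := G.exists_smoothingReturns zref he hD hz₀
    refine ⟨k, _, hk, G.iterate_mem zref hμ hz₀ k, ?_⟩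
    have : G.callBound zref γ = ⊤ := by
      rw [callBound, h0, ENNReal.div_zero (ENNReal.ofReal_pos.2 hnum).ne']
    simp [this]
  have hfin : G.modulus ≠ ⊤ := ((G.modulus_le hz₀ hpos).trans_lt ENNReal.ofReal_lt_top).ne
  set δ := G.modulus.toReal with hδ_def
  have hδ : 0 < δ := ENNReal.toReal_pos h0 hfin
  have hmod : G.modulus = ENNReal.ofReal δ := (ENNReal.ofReal_toReal hfin).symm
  have hdist : δ * G.dist z₀ ≤ G.gap z₀ := by
    have h := G.modulus_mul_dist_le hz₀
    rwa [hmod, ← ENNReal.ofReal_mul hδ.le, ENNReal.ofReal_le_ofReal_iff hpos.le] at h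
  have hb : G.callBound zref γ =
      ENNReal.ofReal (2 * √2 * γ * G.opNorm * √(regMax zref) / δ) := by
    rw [callBound, hmod, ENNReal.ofReal_div_of_pos hδ]
  set X := 2 * √2 * γ * G.opNorm * √(regMax zref) / δ with hX_def
  have hX : 0 < X := by positivity
  -- The procedure always performs one iteration, so the bound must be at least `1`; this uses that
  -- the modulus is finite.
  have hk1 : 1 ≤ ⌈X⌉₊ := Nat.ceil_pos.2 hX
  have hsq : X ^ 2 * δ ^ 2 = 8 * γ ^ 2 * G.opNorm ^ 2 * regMax zref := by
    rw [hX_def, div_pow, div_mul_cancel₀ _ (by positivity), mul_pow, mul_pow, mul_pow, mul_pow,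
      Real.sq_sqrt zero_le_two, Real.sq_sqrt hD.le]
    ring
  have hle : 8 * G.opNorm ^ 2 * regMax zref * G.dist z₀ ^ 2 ≤ e ^ 2 * (⌈X⌉₊ : ℝ) ^ 2 := by
    have h1 : X ^ 2 ≤ (⌈X⌉₊ : ℝ) ^ 2 := pow_le_pow_left₀ hX.le (Nat.le_ceil X) 2
    have h2 : (δ * G.dist z₀) ^ 2 ≤ (γ * e) ^ 2 :=
      pow_le_pow_left₀ (mul_nonneg hδ.le (G.dist_nonneg z₀)) (hdist.trans hgap) 2
    have h3 := mul_le_mul_of_nonneg_left h2 (sq_nonneg X)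
    have h4 : γ ^ 2 * (8 * G.opNorm ^ 2 * regMax zref * G.dist z₀ ^ 2) ≤
        γ ^ 2 * (e ^ 2 * X ^ 2) := by
      have : X ^ 2 * (δ * G.dist z₀) ^ 2 =
          γ ^ 2 * (8 * G.opNorm ^ 2 * regMax zref * G.dist z₀ ^ 2) := by
        rw [mul_pow, ← mul_assoc, hsq]; ring
      rw [← this]; linarith
    exact (le_of_mul_le_mul_left h4 (by positivity)).trans
      (mul_le_mul_of_nonneg_left h1 (sq_nonneg e))
  obtain ⟨k, hk, hr⟩ := G.exists_smoothingReturns_of_le zref hk1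
    (G.gap_smoothingState_le_of_le zref he hD hz₀ hk1 hle)
  refine ⟨k, _, hr, G.iterate_mem zref hμ hz₀ k, ?_⟩
  have h5 : ((⌈X⌉₊ : ℕ) : ℕ∞) ≤ ENat.ceil (G.callBound zref γ) := by
    rw [hb, ENat.ceil_ofReal hX.le]
  exact le_trans (by exact_mod_cast hk) h5

/-- `N` bounds the calls still to come: each divides `e` by `γ` and restores `gap z ≤ e`. -/
lemma exists_outerLoop {γ ε : ℝ} (hγ : 1 < γ) (hε : 0 < ε) (N : ℕ) :
    ∀ {z : JointMat a b} {e : ℝ}, z ∈ jointStates a b → G.gap z ≤ e → e ≤ ε * γ ^ N →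
      ∃ (n : ℕ) (out : JointMat a b), G.OuterLoop zref γ ε z e n out ∧
        G.IsEpsEquilibrium ε out ∧ (n : ℕ∞) ≤ N * ENat.ceil (G.callBound zref γ) := by
  have hγ0 : 0 < γ := by linarith
  induction N with
  | zero =>
    intro z e hz hg he
    have h : G.gap z ≤ ε := by linarith
    exact ⟨0, z, .halt h, ⟨hz, h⟩, by simp⟩
  | succ N ih =>
    intro z e hz hg he
    rcases le_or_gt (G.gap z) ε with h | h
    · exact ⟨0, z, .halt h, ⟨hz, h⟩, by simp⟩
    have hpos := hε.trans h
    obtain ⟨k, z', hr, hz', hk⟩ := G.smoothingReturns_call zref hγ0 (e := e / γ)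
      (div_pos (hpos.trans_le hg) hγ0) hz hpos (by rwa [mul_div_cancel₀ _ hγ0.ne'])
    obtain ⟨n, out, ho, heq, hn⟩ := ih hz' hr.2.2.1 (by
      rw [div_le_iff₀ hγ0, mul_assoc, ← pow_succ]; exact he)
    refine ⟨k + n, out, .restart h hr ho, heq, ?_⟩
    push_cast
    rw [add_mul, one_mul, add_comm]
    exact add_le_add hn hk

/-- `IterSmooth` terminates, with the iteration bound in terms of the error-bound modulus. -/
lemma exists_iterSmooth {γ ε : ℝ} (hγ : 1 < γ) (hε : 0 < ε) (hz₀ : z₀ ∈ jointStates a b) :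
    ∃ (n : ℕ) (out : JointMat a b),
      G.IterSmooth zref γ ε z₀ n out ∧ G.IsEpsEquilibrium ε out ∧
      (n : ℕ∞) ≤ (⌈Real.log (2 * G.opNorm / ε) / Real.log γ⌉₊ : ℕ∞) *
        ENat.ceil (G.callBound zref γ) := by
  rcases le_or_gt (G.gap z₀) ε with h | h
  · exact ⟨0, z₀, .halt h, ⟨hz₀, h⟩, by simp⟩
  refine G.exists_outerLoop zref hγ hε _ hz₀ le_rfl ?_
  have hM := G.opNorm_pos hz₀ (hε.trans h)
  have hγ0 : 0 < γ := by linarith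
  have h1 := Nat.le_ceil (Real.log (2 * G.opNorm / ε) / Real.log γ)
  rw [div_le_iff₀ (Real.log_pos hγ), ← Real.log_pow,
    Real.log_le_log_iff (by positivity) (by positivity), div_le_iff₀ hε] at h1
  linarith [G.gap_le_two_mul_opNorm hz₀]

/-- The number of calls times the rounded iteration bound per call, in terms of the condition
measure. -/
lemma ceil_mul_ceil_callBound_le {γ ε : ℝ} (hγ : 1 < γ) (hε : 0 < ε)
    (hz₀ : z₀ ∈ jointStates a b) (hzref : zref ∈ jointStates a b) (hpos : 0 < G.gap z₀)
    (hle : ε ≤ G.opNorm / 2) {n : ℕ}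
    (hn : (n : ℕ∞) ≤ (⌈Real.log (2 * G.opNorm / ε) / Real.log γ⌉₊ : ℕ∞) *
        ENat.ceil (G.callBound zref γ)) :
    (n : ℝ≥0∞) ≤
      ENNReal.ofReal ((2 / Real.log γ + 1 / Real.log 2) * (4 * √2 * γ + √2)) * G.condMeasure *
        ENNReal.ofReal (Real.log (G.opNorm / ε)) := by
  have hM := G.opNorm_pos hz₀ hpos
  have hlγ := Real.log_pos hγ
  have hl2 := Real.log_pos one_lt_two
  have h2 : 2 ≤ G.opNorm / ε := by rw [le_div_iff₀ hε]; linarith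
  have hl : Real.log 2 ≤ Real.log (G.opNorm / ε) := Real.log_le_log two_pos h2
  have hl0 : 0 < Real.log (G.opNorm / ε) := hl2.trans_le hl
  rcases eq_or_ne G.modulus 0 with h0 | h0
  · have : G.condMeasure = ⊤ := by
      rw [condMeasure, h0, ENNReal.div_zero (ENNReal.ofReal_pos.2 hM).ne']
    rw [this, ENNReal.mul_top (ENNReal.ofReal_pos.2 (by positivity)).ne',
      ENNReal.top_mul (ENNReal.ofReal_pos.2 hl0).ne']
    exact le_top
  have hmodle := G.modulus_le hz₀ hpos
  have hfin : G.modulus ≠ ⊤ := (hmodle.trans_lt ENNReal.ofReal_lt_top).ne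
  set δ := G.modulus.toReal with hδ_def
  have hδ : 0 < δ := ENNReal.toReal_pos h0 hfin
  have hmod : G.modulus = ENNReal.ofReal δ := (ENNReal.ofReal_toReal hfin).symm
  rw [hmod, ENNReal.ofReal_le_ofReal_iff (by positivity)] at hmodle
  have hκ : G.condMeasure = ENNReal.ofReal (G.opNorm / δ) := by
    rw [condMeasure, hmod, ENNReal.ofReal_div_of_pos hδ]
  set κ := G.opNorm / δ with hκ_def
  have hκ0 : 0 < κ := by positivity
  -- Since the gap is `√2 ‖F‖`-Lipschitz, `κ` cannot be small; this absorbs the `+ 1` of the ceiling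
  -- and is the source of the summand `√2` in `C`.
  have hκ1 : 1 ≤ √2 * κ := by rw [hκ_def, ← mul_div_assoc, le_div_iff₀ hδ]; linarith
  have hb : G.callBound zref γ ≤ ENNReal.ofReal (4 * √2 * γ * κ) := by
    rw [callBound, hmod, ← ENNReal.ofReal_div_of_pos hδ]
    refine ENNReal.ofReal_le_ofReal ?_
    have h4 : √(regMax zref) ≤ 2 := Real.sqrt_le_iff.2 ⟨zero_le_two, by
      linarith [regMax_le_four hzref]⟩
    rw [hκ_def, ← mul_div_assoc]
    refine div_le_div_of_nonneg_right ?_ hδ.le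
    have := mul_le_mul_of_nonneg_left h4 (by positivity : 0 ≤ 2 * √2 * γ * G.opNorm)
    linarith
  have hceil : ENat.ceil (G.callBound zref γ) ≤ (⌈4 * √2 * γ * κ⌉₊ : ℕ∞) := by
    rw [← ENat.ceil_ofReal (by positivity)]
    exact ENat.ceil_le_ceil hb
  have hn' : n ≤ ⌈Real.log (2 * G.opNorm / ε) / Real.log γ⌉₊ * ⌈4 * √2 * γ * κ⌉₊ := by
    exact_mod_cast hn.trans (mul_le_mul_right hceil _)
  have hc1 : (⌈4 * √2 * γ * κ⌉₊ : ℝ) ≤ (4 * √2 * γ + √2) * κ := by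
    have := (Nat.ceil_lt_add_one (by positivity : 0 ≤ 4 * √2 * γ * κ)).le
    linarith
  have hc2 : (⌈Real.log (2 * G.opNorm / ε) / Real.log γ⌉₊ : ℝ) ≤
      (2 / Real.log γ + 1 / Real.log 2) * Real.log (G.opNorm / ε) := by
    have h5 : Real.log (2 * G.opNorm / ε) = Real.log 2 + Real.log (G.opNorm / ε) := by
      rw [mul_div_assoc, Real.log_mul two_ne_zero (by positivity)]
    have h6 : 0 ≤ Real.log (2 * G.opNorm / ε) / Real.log γ := by rw [h5]; positivity
    have h7 := (Nat.ceil_lt_add_one h6).le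
    have h8 : Real.log (2 * G.opNorm / ε) / Real.log γ ≤
        2 / Real.log γ * Real.log (G.opNorm / ε) := by
      rw [div_mul_eq_mul_div, h5]
      exact div_le_div_of_nonneg_right (by linarith) hlγ.le
    have h9 : 1 ≤ 1 / Real.log 2 * Real.log (G.opNorm / ε) := by
      rw [div_mul_eq_mul_div, one_mul, le_div_iff₀ hl2]; linarith
    linarith
  rw [hκ, ← ENNReal.ofReal_mul (by positivity), ← ENNReal.ofReal_mul (by positivity),
    ← ENNReal.ofReal_natCast]
  refine ENNReal.ofReal_le_ofReal ?_
  calc (n : ℝ) ≤ (⌈Real.log (2 * G.opNorm / ε) / Real.log γ⌉₊ : ℝ) * ⌈4 * √2 * γ * κ⌉₊ := by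
        exact_mod_cast hn'
    _ ≤ ((2 / Real.log γ + 1 / Real.log 2) * Real.log (G.opNorm / ε)) *
        ((4 * √2 * γ + √2) * κ) := mul_le_mul hc2 hc1 (by positivity) (by positivity)
    _ = _ := by ring

end IterSmooth

end QuantumGame

end

/-! ### The complexity theorem. -/

theorem theorem4p1 (γ : ℝ) (hγ : 1 < γ) :
    (∃ C : ℝ, 0 < C ∧
      ∀ (a b : ℕ) (Ω : Type*) [Fintype Ω] (G : QuantumGame a b Ω) (zref z₀ : JointMat a b),
        zref ∈ jointStates a b → z₀ ∈ jointStates a b →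
        ∀ ε : ℝ, 0 < ε → ε ≤ G.opNorm / 2 →
          ∃ (n : ℕ) (out : JointMat a b),
            G.IterSmooth zref γ ε z₀ n out ∧ G.IsEpsEquilibrium ε out ∧
            (n : ℝ≥0∞) ≤
              ENNReal.ofReal C * G.condMeasure * ENNReal.ofReal (Real.log (G.opNorm / ε))) ∧
    (∀ (a b : ℕ) (Ω : Type*) [Fintype Ω] (G : QuantumGame a b Ω) (zref z₀ : JointMat a b),
        zref ∈ jointStates a b → z₀ ∈ jointStates a b →
        ∀ ε : ℝ, 0 < ε →
          ∃ (n : ℕ) (out : JointMat a b),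
            G.IterSmooth zref γ ε z₀ n out ∧ G.IsEpsEquilibrium ε out ∧
            (n : ℕ∞) ≤
              (⌈Real.log (2 * G.opNorm / ε) / Real.log γ⌉₊ : ℕ∞) *
                ENat.ceil (ENNReal.ofReal
                  (2 * Real.sqrt 2 * γ * G.opNorm * Real.sqrt (regMax zref)) / G.modulus)) := by
  have hγ0 : 0 < γ := one_pos.trans hγ
  have hlγ := Real.log_pos hγ
  have hl2 := Real.log_pos one_lt_two
  refine ⟨⟨(2 / Real.log γ + 1 / Real.log 2) * (4 * √2 * γ + √2), by positivity, ?_⟩, ?_⟩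
  · intro a b Ω _ G zref z₀ hzref hz₀ ε hε hle
    -- The first case contains all games of infinite modulus, where the claimed bound is `0`: by
    -- `modulus_le`, a positive gap forces a finite modulus.
    rcases le_or_gt (G.gap z₀) ε with h | h
    · exact ⟨0, z₀, .halt h, ⟨hz₀, h⟩, by simp⟩
    · obtain ⟨n, out, hrun, heq, hn⟩ := G.exists_iterSmooth zref hγ hε hz₀
      exact ⟨n, out, hrun, heq,
        G.ceil_mul_ceil_callBound_le zref hγ hε hz₀ hzref (hε.trans h) hle hn⟩
  · intro a b Ω _ G zref z₀ _ hz₀ ε hε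
    exact G.exists_iterSmooth zref hγ hε hz₀
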